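/- Let $\lambda,\kappa,\psi\in\mathbb{R}$ be admissible, i.e. $\lambda<0,\kappa>0,\psi\ge 0$, or $\lambda=0,\kappa>0,\psi>0$, or $\lambda>0,\kappa\ge 0,\psi>0$. Let $\mathrm{GIG}(\lambda,\kappa,\psi)$ be the generalized inverse Gaussian law on $(0,\infty)$, whose density is proportional to $x^{\lambda-1}\exp\{-\tfrac12(\kappa/x+\psi x)\}$. For $\gamma,\mu\in\mathbb{R}^2$ and a positive definite matrix $\Sigma$, the generalized hyperbolic law $\mathrm{GH}_2(\lambda,\kappa,\psi,\gamma,\mu,\Sigma)$ is the law of $\mu+\gamma R+\sqrt{R}\,W$, where $R\sim\mathrm{GIG}(\lambda,\kappa,\psi)$ and $W\sim\mathcal N_2(0,\Sigma)$ are independent. Let $(X_1,X_2)$ be random variables with joint law $\mathrm{GH}_2(\lambda,\kappa,\psi,\gamma,\mu,\Sigma)$, where $\gamma=(\gamma_1,\gamma_2)$, $\mu=(\mu_1,\mu_2)$, $\Sigma=\begin{pmatrix}1&\rho\\ \rho&1\end{pmatrix}$ and $|\rho|<1$, and let $F_1,F_2$ be the distribution functions of $X_1,X_2$. If $\psi>0$,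 then: (i) $X_1$ and $X_2$ are asymptotically independent, i.e. $\chi=\lim_{u\to1^-}\Pr\{F_1(X_1)>u,F_2(X_2)>u\}/\Pr\{F_1(X_1)>u\}$ exists and equals $0$; (ii) their residual tail dependence coefficient exists and equals \[ \eta=\frac{1-\rho^2}{\sqrt{\{\psi(1-\rho^2)+\gamma_1^2-2\rho\gamma_1\gamma_2+\gamma_2^2\}(m_1^2-2\rho m_1m_2+m_2^2)}-m_1(\gamma_1-\rho\gamma_2)-m_2(\gamma_2-\rho\gamma_1)}, \qquad m_i=\frac{\gamma_i+\sqrt{\psi+\gamma_i^2}}{\psi}\quad(i=1,2), \] that is, $\eta\in(0,1]$ and there is a slowly varying function $L$ (measurable and positive on $(0,\infty)$, with $L(tx)/L(x)\to1$ as $x\to\infty$ for every $t>0$) such that \[ \Pr\{F_1(X_1)>u,F_2(X_2)>u\}\sim L\{(1-u)^{-1}\}\,(1-u)^{1/\eta}\qquad\text{as } u\to1^-. \] -/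

import Mathlib

open MeasureTheory ProbabilityTheory Filter Topology Set

noncomputable section

namespace GHTail

/-- The modified Bessel function of the second kind, for `z > 0`, by its integral representation
`K_lam(z) = (1/2) ∫_0^∞ y^(lam-1) exp(-(z/2)(y + 1/y)) dy`. -/
def besselK (lam z : ℝ) : ℝ :=
  (1 / 2) * ∫ y in Ioi (0 : ℝ), y ^ (lam - 1) * Real.exp (-(z / 2) * (y + 1 / y))

/-- The admissible parameters of the generalized inverse Gaussian and of the generalized
hyperbolic distributions; `κ = 0` and `ψ = 0` are the two limiting cases. -/
def Admissible (lam κ ψ : ℝ) : Prop :=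
  (lam < 0 ∧ 0 < κ ∧ 0 ≤ ψ) ∨ (lam = 0 ∧ 0 < κ ∧ 0 < ψ) ∨ (0 < lam ∧ 0 ≤ κ ∧ 0 < ψ)

/-- The unnormalized generalized inverse Gaussian density, for `x > 0`. -/
def gigKernel (lam κ ψ x : ℝ) : ℝ :=
  x ^ (lam - 1) * Real.exp (-(1 / 2) * (κ / x + ψ * x))

/-- The density of the generalized inverse Gaussian distribution, normalized by its integral, so
that the limiting cases `κ = 0` (a gamma law) and `ψ = 0` (an inverse gamma law) are covered by the
same formula. For `κ, ψ > 0` it is the usual density with a Bessel function in the normalizing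
constant, see `gigPDF_eq_besselK`; for `κ = 0` see `gigPDF_zero_eq_gamma`. -/
def gigPDF (lam κ ψ x : ℝ) : ℝ :=
  if 0 < x then gigKernel lam κ ψ x / ∫ t in Ioi (0 : ℝ), gigKernel lam κ ψ t else 0

/-- The generalized inverse Gaussian law `GIG(lam, κ, ψ)`. -/
def gigMeasure (lam κ ψ : ℝ) : Measure ℝ :=
  volume.withDensity fun x => ENNReal.ofReal (gigPDF lam κ ψ x)

/-- The generalized hyperbolic law `GH_d(lam, κ, ψ, γ, μ, S)`: the law of the normal mean-variance
mixture `μ + R γ + √R W`, with `R ∼ GIG(lam, κ, ψ)` and `W ∼ N_d(0, S)` independent. -/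
def ghMeasure {d : ℕ} (lam κ ψ : ℝ) (γ μ : EuclideanSpace ℝ (Fin d))
    (S : Matrix (Fin d) (Fin d) ℝ) : Measure (EuclideanSpace ℝ (Fin d)) :=
  ((gigMeasure lam κ ψ).prod (multivariateGaussian 0 S)).map
    fun p => μ + p.1 • γ + Real.sqrt p.1 • p.2

section TailDependence

variable {Ω : Type*} [MeasurableSpace Ω]

/-- `Pr{F_1(X_1) > u, F_2(X_2) > u}`, where `F_i` is the distribution function of `X_i`. -/
def jointTail (X₁ X₂ : Ω → ℝ) (P : Measure Ω) (u : ℝ) : ℝ :=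
  P.real {ω | u < cdf (P.map X₁) (X₁ ω) ∧ u < cdf (P.map X₂) (X₂ ω)}

/-- `Pr{F(X) > u}`, where `F` is the distribution function of `X`. -/
def marginalTail (X : Ω → ℝ) (P : Measure Ω) (u : ℝ) : ℝ :=
  P.real {ω | u < cdf (P.map X) (X ω)}

/-- The (upper) tail dependence coefficient of `(X₁, X₂)` exists and equals `χ`. -/
def HasTailDependenceCoeff (X₁ X₂ : Ω → ℝ) (P : Measure Ω) (χ : ℝ) : Prop :=
  Tendsto (fun u => jointTail X₁ X₂ P u / marginalTail X₁ P u) (𝓝[<] 1) (𝓝 χ)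

/-- Asymptotic independence: the tail dependence coefficient exists and is zero. -/
def AsymptoticallyIndependent (X₁ X₂ : Ω → ℝ) (P : Measure Ω) : Prop :=
  HasTailDependenceCoeff X₁ X₂ P 0

/-- Slowly varying functions at infinity (positive and measurable on `(0, ∞)`; the values
elsewhere play no role). -/
structure SlowlyVarying (L : ℝ → ℝ) : Prop where
  measurable : Measurable L
  pos : ∀ x, 0 < x → 0 < L x
  tendsto : ∀ t, 0 < t → Tendsto (fun x => L (t * x) / L x) atTop (𝓝 1)

/-- The residual tail dependence coefficient of `(X₁, X₂)` exists and equals `η ∈ (0, 1]`: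
`Pr{F_1(X_1) > u, F_2(X_2) > u} ∼ L((1 - u)⁻¹) (1 - u)^(1/η)` as `u → 1`, with `L` slowly
varying. -/
def HasResidualTailDependenceCoeff (X₁ X₂ : Ω → ℝ) (P : Measure Ω) (η : ℝ) : Prop :=
  0 < η ∧ η ≤ 1 ∧ ∃ L : ℝ → ℝ, SlowlyVarying L ∧
    Tendsto (fun u => jointTail X₁ X₂ P u / (L ((1 - u)⁻¹) * (1 - u) ^ (1 / η)))
      (𝓝[<] 1) (𝓝 1)

end TailDependence

/-- For `κ, ψ > 0` the density is
`(ψ/κ)^(lam/2) x^(lam-1) / (2 K_lam(√(κψ))) exp(-(κ/x + ψx)/2)`. -/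
theorem gigPDF_eq_besselK {lam κ ψ x : ℝ} (hκ : 0 < κ) (hψ : 0 < ψ) (hx : 0 < x) :
    gigPDF lam κ ψ x = (ψ / κ) ^ (lam / 2) * (x ^ (lam - 1) / (2 * besselK lam (Real.sqrt (κ * ψ))))
      * Real.exp (-(1 / 2) * (κ / x + ψ * x)) := by
  set b : ℝ := Real.sqrt (κ / ψ) with hb
  have hb0 : 0 < b := Real.sqrt_pos.2 (div_pos hκ hψ)
  set z : ℝ := Real.sqrt (κ * ψ) with hz
  have hz0 : 0 < z := Real.sqrt_pos.2 (mul_pos hκ hψ)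
  have hb2 : b ^ 2 = κ / ψ := Real.sq_sqrt (div_pos hκ hψ).le
  have hzb : z = ψ * b := by
    rw [hz, Real.sqrt_eq_iff_mul_self_eq_of_pos (mul_pos hψ hb0)]
    have : ψ * b * (ψ * b) = ψ ^ 2 * b ^ 2 := by ring
    rw [this, hb2]; field_simp
  have hκb : κ = ψ * b ^ 2 := by rw [hb2]; field_simp
  have key : ∫ t in Ioi (0 : ℝ), gigKernel lam κ ψ t = b ^ lam * (2 * besselK lam z) := by
    have h := integral_comp_mul_left_Ioi' (fun t => gigKernel lam κ ψ t) 0 hb0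
    rw [mul_zero] at h
    rw [← h, besselK, ← mul_assoc 2, show (2 : ℝ) * (1 / 2) = 1 by norm_num, one_mul,
      ← integral_const_mul, smul_eq_mul, ← integral_const_mul]
    refine setIntegral_congr_fun measurableSet_Ioi fun y hy => ?_
    have hy : 0 < y := hy
    simp only [gigKernel]
    rw [Real.mul_rpow hb0.le hy.le, Real.rpow_sub_one hb0.ne', hzb, hκb]
    have he : -(1 / 2) * (ψ * b ^ 2 / (b * y) + ψ * (b * y)) = -(ψ * b / 2) * (y + 1 / y) := by
      field_simp
      ring
    rw [he]
    field_simp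
  have hpow : (ψ / κ) ^ (lam / 2) = (b ^ lam)⁻¹ := by
    rw [hb, Real.sqrt_eq_rpow, ← Real.rpow_mul (div_pos hκ hψ).le, ← inv_div κ ψ,
      Real.inv_rpow (div_pos hκ hψ).le]
    congr 2
    ring
  rw [gigPDF, if_pos hx, key, hpow, gigKernel]
  simp only [div_eq_mul_inv, mul_inv]
  ring

/-- For `κ = 0` the law is the gamma law with shape `lam` and rate `ψ / 2`. -/
theorem gigPDF_zero_eq_gamma {lam ψ x : ℝ} (hlam : 0 < lam) (hψ : 0 < ψ) (hx : 0 < x) :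
    gigPDF lam 0 ψ x = gammaPDFReal lam (ψ / 2) x := by
  have hk : ∀ t, gigKernel lam 0 ψ t = t ^ (lam - 1) * Real.exp (-(ψ / 2 * t)) := by
    intro t
    simp only [gigKernel, zero_div, zero_add]
    congr 2
    ring
  rw [gigPDF, if_pos hx, gammaPDFReal, if_pos hx.le]
  simp only [hk]
  rw [Real.integral_rpow_mul_exp_neg_mul_Ioi hlam (half_pos hψ),
    Real.div_rpow zero_le_one (half_pos hψ).le, Real.one_rpow]
  have h1 := (Real.Gamma_pos_of_pos hlam).ne'
  have h2 := (Real.rpow_pos_of_pos (half_pos hψ) lam).ne'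
  field_simp

end GHTail

end

/-!
# Residual tail dependence of the bivariate generalized hyperbolic law

Conditionally on the mixing variable the law is Gaussian, so integrating the mixing variable out
yields explicit densities: up to constants, `e^(γᵢ x) Hᵢ(√(κ + (x - μᵢ)²))` for the marginals and
`e^(⟪γ, y⟫) H(√(κ + ‖y - μ‖²))` for the pair. Here norm and inner product are those of `Σ⁻¹`, and
`H` is the normalizing integral of a generalized inverse Gaussian density (a Bessel function in
disguise). Exact Bessel asymptotics are not needed. All that matters is that `H` has exponential
rate `√A` in the sense of `HasExpRate`: the increments of `log H` are asymptotic to `-√A` times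
those of the argument. This is `hasExpRate_integral_gigKernel`; it follows from the fact that
`p ↦ e^((√A + ε) p) H(p)` is, up to a power of `p`, a convex unbounded function, whereas
`p ↦ e^(√A p) H(p)` is, up to the same power, decreasing.

The `i`-th marginal tail therefore has exponential rate `√(ψ + γᵢ²) - γᵢ = 1 / mᵢ`, and the
quantile at level `1 - 1/s` satisfies `q(s) ~ mᵢ log s` and `q(t s) - q(s) → mᵢ log t`
(`exists_quantile_of_hasExpRate`). For the pair, the density decays like `e^(-r(y))` with
`r(y) = √A ‖y‖ - ⟪γ, y⟫`, which is convex and homogeneous. When the corner `y` of a quadrant goes to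
infinity in the direction `m = (m₁, m₂)`, dominated convergence shows that the integral of the
density over the quadrant is asymptotically a constant multiple of the density at the corner,
provided that both components of `∇r(m)` are positive. Hence a shift of the corner by `b`
multiplies the joint tail by `e^(-∇r(m) · b)` in the limit
(`tendsto_integral_quadrant_shift_div`). With `b = (log t) m` and Euler's identity
`∇r(m) · m = r(m)`, the joint tail at level `1 - 1/s` is regularly varying in `s` with index
`-r(m)`, so that `η = 1 / r(m)`, which is the formula claimed.

The algebraic facts behind this are `corner_rate_pos`, that `∇r(m)` has positive components,
and `one_lt_joint_rate`, that `r(m) > 1`. The latter gives `η < 1` and thereby asymptotic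
independence.
-/

namespace GHTail

/-! ### Functions with an exponential rate of decay -/

/-- `φ` decays at infinity with exponential rate `θ`: for every `ε > 0` the increments of `log φ`
are within `ε |y - x|` of `-θ (y - x)` as soon as `x` and `y` are large. The inequality is
one-sided, but it is required for `(x, y)` and `(y, x)` alike. -/
def HasExpRate (θ : ℝ) (φ : ℝ → ℝ) : Prop :=
  ∀ ε > 0, ∃ x₀, ∀ x ≥ x₀, ∀ y ≥ x₀, φ y ≤ Real.exp (-θ * (y - x) + ε * |y - x|) * φ x

namespace HasExpRate

variable {θ : ℝ} {φ : ℝ → ℝ}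

theorem tendsto_div (h : HasExpRate θ φ) (hpos : ∀ x, 0 < φ x) {ι : Type*} {l : Filter ι}
    {u v : ι → ℝ} {c : ℝ} (hu : Tendsto u l atTop) (hv : Tendsto (fun i => v i - u i) l (𝓝 c)) :
    Tendsto (fun i => φ (v i) / φ (u i)) l (𝓝 (Real.exp (-θ * c))) := by
  have hv' : Tendsto v l atTop := by
    have := hu.atTop_add hv
    simpa using this
  have hlog : Tendsto (fun i => Real.log (φ (v i) / φ (u i))) l (𝓝 (-θ * c)) := by
    have key : Tendsto (fun i => Real.log (φ (v i) / φ (u i)) - -θ * (v i - u i)) l (𝓝 0) := by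
      rw [Metric.tendsto_nhds]
      intro δ hδ
      have hc : 0 < |c| + 1 := by positivity
      obtain ⟨x₀, hx₀⟩ := h (δ / (2 * (|c| + 1))) (by positivity)
      have hb : ∀ᶠ i in l, |v i - u i| < |c| + 1 :=
        hv.abs.eventually_lt_const (by linarith)
      filter_upwards [hu.eventually_ge_atTop x₀, hv'.eventually_ge_atTop x₀, hb] with i h1 h2 h3
      have a1 := hx₀ _ h1 _ h2
      have a2 := hx₀ _ h2 _ h1
      rw [← div_le_iff₀ (hpos _), ← Real.log_le_iff_le_exp (div_pos (hpos _) (hpos _))] at a1 a2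
      have hinv : Real.log (φ (u i) / φ (v i)) = -Real.log (φ (v i) / φ (u i)) := by
        rw [← Real.log_inv, inv_div]
      have hε : δ / (2 * (|c| + 1)) * |v i - u i| < δ := by
        have := mul_le_mul_of_nonneg_left h3.le (show 0 ≤ δ / (2 * (|c| + 1)) by positivity)
        have e : δ / (2 * (|c| + 1)) * (|c| + 1) = δ / 2 := by field_simp
        linarith
      rw [hinv, abs_sub_comm] at a2
      rw [Real.dist_eq, sub_zero, abs_lt]
      constructor <;> linarith
    have := key.add (hv.const_mul (-θ))
    simpa using this
  have := (Real.continuous_exp.tendsto _).comp hlog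
  refine this.congr fun i => ?_
  simp [Real.exp_log (div_pos (hpos (v i)) (hpos (u i)))]

theorem tendsto_log_div (h : HasExpRate θ φ) (hpos : ∀ x, 0 < φ x) :
    Tendsto (fun x => Real.log (φ x) / x) atTop (𝓝 (-θ)) := by
  rw [Metric.tendsto_nhds]
  intro δ hδ
  obtain ⟨x₀, hx₀⟩ := h (δ / 2) (by positivity)
  have hbig : ∀ᶠ x in atTop, 2 / δ * (|Real.log (φ x₀)| + |θ * x₀| + δ / 2 * |x₀|) < x :=
    eventually_gt_atTop _
  filter_upwards [eventually_ge_atTop x₀, eventually_gt_atTop 0, hbig] with x h1 h2 h3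
  have a1 := hx₀ _ le_rfl _ h1
  have a2 := hx₀ _ h1 _ le_rfl
  rw [← div_le_iff₀ (hpos _), ← Real.log_le_iff_le_exp (div_pos (hpos _) (hpos _)),
    Real.log_div (hpos _).ne' (hpos _).ne'] at a1 a2
  rw [abs_sub_comm] at a2
  rw [abs_of_nonneg (sub_nonneg.2 h1)] at a1 a2
  have h3' : |Real.log (φ x₀)| + |θ * x₀| + δ / 2 * |x₀| < δ / 2 * x := by
    have := mul_lt_mul_of_pos_left h3 (half_pos hδ)
    have e : δ / 2 * (2 / δ * (|Real.log (φ x₀)| + |θ * x₀| + δ / 2 * |x₀|))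
      = |Real.log (φ x₀)| + |θ * x₀| + δ / 2 * |x₀| := by field_simp
    linarith
  have b1 := le_abs_self (Real.log (φ x₀))
  have b2 := neg_abs_le (Real.log (φ x₀))
  have b3 := le_abs_self (θ * x₀)
  have b4 := neg_abs_le (θ * x₀)
  have b5 := mul_le_mul_of_nonneg_left (neg_abs_le x₀) (half_pos hδ).le
  rw [Real.dist_eq, show Real.log (φ x) / x - -θ = (Real.log (φ x) + θ * x) / x by field_simp; ring,
    abs_div, abs_of_pos h2, div_lt_iff₀ h2, abs_lt]
  constructor <;> nlinarith

/-- The tail integral of a function inherits its exponential rate. -/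
theorem tail (h : HasExpRate θ φ) (hint : Integrable φ) :
    HasExpRate θ fun x => ∫ a in Ioi (0 : ℝ), φ (a + x) := by
  intro ε hε
  obtain ⟨x₀, hx₀⟩ := h ε hε
  refine ⟨x₀, fun x hx y hy => ?_⟩
  simp only
  rw [← integral_const_mul]
  refine setIntegral_mono_on (hint.comp_add_right y).integrableOn
    ((hint.comp_add_right x).integrableOn.const_mul _) measurableSet_Ioi fun a ha => ?_
  have ha : 0 < a := ha
  have := hx₀ (a + x) (by linarith) (a + y) (by linarith)
  simpa using this

end HasExpRate

/-! ### The normalizing integral of the generalized inverse Gaussian density -/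

theorem gigKernel_pos {ν κ ψ x : ℝ} (hx : 0 < x) : 0 < gigKernel ν κ ψ x :=
  mul_pos (Real.rpow_pos_of_pos hx _) (Real.exp_pos _)

theorem measurable_gigKernel (ν κ ψ : ℝ) : Measurable (gigKernel ν κ ψ) := by
  unfold gigKernel; fun_prop

theorem integrableOn_gigKernel (ν : ℝ) {κ ψ : ℝ} (hκ : 0 < κ) (hψ : 0 < ψ) :
    IntegrableOn (gigKernel ν κ ψ) (Ioi 0) := by
  -- The factor `exp (-κ / (2 x))` is at most `n! (2 x / κ) ^ n`, which makes the singularity at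
  -- `0` integrable as soon as `ν + n > 0`.
  obtain ⟨n, hn⟩ := exists_nat_gt (-ν)
  have hg : IntegrableOn (fun x : ℝ => x ^ (ν - 1 + n) * Real.exp (-(ψ / 2) * x ^ (1 : ℝ)))
      (Ioi 0) :=
    integrableOn_rpow_mul_exp_neg_mul_rpow (by linarith) one_pos (half_pos hψ)
  refine Integrable.mono' (hg.const_mul (n.factorial * (2 / κ) ^ n))
    (measurable_gigKernel ν κ ψ).aestronglyMeasurable ?_
  refine (ae_restrict_iff' measurableSet_Ioi).2 (Eventually.of_forall fun x hx => ?_)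
  have hx : 0 < x := hx
  rw [Real.norm_of_nonneg (gigKernel_pos hx).le, gigKernel, Real.rpow_one,
    Real.rpow_add hx, Real.rpow_natCast]
  have h1 : Real.exp (-(1 / 2) * (κ / x + ψ * x))
      = Real.exp (-(κ / (2 * x))) * Real.exp (-(ψ / 2) * x) := by
    rw [← Real.exp_add]; congr 1; field_simp; ring
  have h2 : Real.exp (-(κ / (2 * x))) ≤ n.factorial * (2 / κ) ^ n * x ^ n := by
    have h3 := Real.pow_div_factorial_le_exp (κ / (2 * x)) (by positivity) n
    rw [Real.exp_neg]
    have h4 : (n.factorial * (2 / κ) ^ n * x ^ n : ℝ) = ((κ / (2 * x)) ^ n / n.factorial)⁻¹ := by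
      rw [inv_div, div_pow, div_pow, mul_pow]
      field_simp
    rw [h4]
    exact inv_anti₀ (by positivity) h3
  rw [h1]
  calc x ^ (ν - 1) * (Real.exp (-(κ / (2 * x))) * Real.exp (-(ψ / 2) * x))
      ≤ x ^ (ν - 1) * ((n.factorial * (2 / κ) ^ n * x ^ n) * Real.exp (-(ψ / 2) * x)) := by
        gcongr
    _ = _ := by ring

theorem integral_gigKernel_pos (ν : ℝ) {κ ψ : ℝ} (hκ : 0 < κ) (hψ : 0 < ψ) :
    0 < ∫ x in Ioi (0 : ℝ), gigKernel ν κ ψ x := by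
  rw [setIntegral_pos_iff_support_of_nonneg_ae]
  · have : Ioi (0 : ℝ) ⊆ Function.support (gigKernel ν κ ψ) ∩ Ioi 0 :=
      fun x hx => ⟨(gigKernel_pos hx).ne', hx⟩
    exact lt_of_lt_of_le (by simp) (measure_mono this)
  · exact (ae_restrict_iff' measurableSet_Ioi).2 (Eventually.of_forall fun x hx =>
      (gigKernel_pos hx).le)
  · exact integrableOn_gigKernel ν hκ hψ

theorem integral_gigKernel_sq (ν A : ℝ) {p : ℝ} (hp : 0 < p) :
    ∫ x in Ioi (0 : ℝ), gigKernel ν (p ^ 2) A x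
      = p ^ ν * ∫ x in Ioi (0 : ℝ), gigKernel ν p (p * A) x := by
  have h := integral_comp_mul_left_Ioi' (fun t => gigKernel ν (p ^ 2) A t) 0 hp
  rw [mul_zero] at h
  rw [← h, smul_eq_mul, ← integral_const_mul, ← integral_const_mul]
  refine setIntegral_congr_fun measurableSet_Ioi fun y hy => ?_
  have hy : 0 < y := hy
  simp only [gigKernel]
  rw [Real.mul_rpow hp.le hy.le, Real.rpow_sub_one hp.ne']
  have he : p ^ 2 / (p * y) + A * (p * y) = p / y + p * A * y := by
    field_simp
  rw [he]
  field_simp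

theorem sqrt_le_gig_exponent {A s : ℝ} (hA : 0 < A) (hs : 0 < s) :
    Real.sqrt A ≤ (1 / 2) * (1 / s + A * s) := by
  have h := Real.sq_sqrt hA.le
  have : (1 / 2) * (1 / s + A * s) - Real.sqrt A = (1 - Real.sqrt A * s) ^ 2 / (2 * s) := by
    field_simp
    nlinarith
  have h2 : 0 ≤ (1 - Real.sqrt A * s) ^ 2 / (2 * s) := by positivity
  linarith

theorem gigKernel_scaled (ν A p s : ℝ) :
    gigKernel ν p (p * A) s = s ^ (ν - 1) * Real.exp (-p * ((1 / 2) * (1 / s + A * s))) := by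
  rw [gigKernel]
  congr 2
  ring

theorem integral_gigKernel_scaled_le (ν : ℝ) {A p q : ℝ} (hA : 0 < A) (hp : 0 < p) (hpq : p ≤ q) :
    ∫ x in Ioi (0 : ℝ), gigKernel ν q (q * A) x
      ≤ Real.exp (-Real.sqrt A * (q - p)) * ∫ x in Ioi (0 : ℝ), gigKernel ν p (p * A) x := by
  have hq : 0 < q := hp.trans_le hpq
  rw [← integral_const_mul]
  refine setIntegral_mono_on (integrableOn_gigKernel ν hq (by positivity))
    ((integrableOn_gigKernel ν hp (by positivity)).const_mul _) measurableSet_Ioi fun s hs => ?_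
  have hs : 0 < s := hs
  rw [gigKernel_scaled, gigKernel_scaled, mul_left_comm (Real.exp _), ← Real.exp_add]
  have := sqrt_le_gig_exponent hA hs
  gcongr
  nlinarith

theorem integrableOn_gigKernel_tilted (ν a : ℝ) {A p : ℝ} (hA : 0 < A) (hp : 0 < p) :
    IntegrableOn (fun s => s ^ (ν - 1) * Real.exp (p * (a - (1 / 2) * (1 / s + A * s))))
      (Ioi 0) := by
  refine ((integrableOn_gigKernel ν hp (mul_pos hp hA)).const_mul (Real.exp (p * a))).congr
    (ae_of_all _ fun s => ?_)
  simp only [gigKernel_scaled]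
  rw [mul_left_comm, ← Real.exp_add]
  congr 2
  ring

theorem convexOn_integral_gigKernel_tilted (ν a : ℝ) {A : ℝ} (hA : 0 < A) :
    ConvexOn ℝ (Ioi 0) fun p => ∫ s in Ioi (0 : ℝ),
      s ^ (ν - 1) * Real.exp (p * (a - (1 / 2) * (1 / s + A * s))) := by
  refine ⟨convex_Ioi 0, fun p hp q hq t u ht hu htu => ?_⟩
  have hpq : t * p + u * q ∈ Ioi (0 : ℝ) := convex_Ioi 0 hp hq ht hu htu
  simp only [smul_eq_mul]
  rw [← integral_const_mul, ← integral_const_mul, ← integral_add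
    ((integrableOn_gigKernel_tilted ν a hA hp).const_mul _)
    ((integrableOn_gigKernel_tilted ν a hA hq).const_mul _)]
  refine setIntegral_mono_on (integrableOn_gigKernel_tilted ν a hA hpq)
    (((integrableOn_gigKernel_tilted ν a hA hp).const_mul _).add
    ((integrableOn_gigKernel_tilted ν a hA hq).const_mul _)) measurableSet_Ioi fun s hs => ?_
  have hs : 0 < s := hs
  set c := a - (1 / 2) * (1 / s + A * s)
  have h := convexOn_exp.2 (mem_univ (p * c)) (mem_univ (q * c)) ht hu htu
  simp only [smul_eq_mul] at h
  have h0 := (Real.rpow_pos_of_pos hs (ν - 1)).le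
  have e : (t * p + u * q) * c = t * (p * c) + u * (q * c) := by ring
  rw [e]
  calc _ ≤ s ^ (ν - 1) * (t * Real.exp (p * c) + u * Real.exp (q * c)) := by gcongr
    _ = _ := by ring

/-- Compensating the integral `K p = ∫ gigKernel ν p (p A)` by an exponential of rate slightly
larger than `√A` makes it eventually increasing, because the compensated integral is convex
and unbounded. -/
theorem exists_integral_gigKernel_scaled_le (ν : ℝ) {A ε : ℝ} (hA : 0 < A) (hε : 0 < ε) :
    ∃ p₀ > 0, ∀ p ≥ p₀, ∀ q ≥ p, ∫ x in Ioi (0 : ℝ), gigKernel ν p (p * A) x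
      ≤ Real.exp ((Real.sqrt A + ε) * (q - p)) *
        ∫ x in Ioi (0 : ℝ), gigKernel ν q (q * A) x := by
  set a := Real.sqrt A + ε with ha
  set c : ℝ → ℝ := fun s => (1 / 2) * (1 / s + A * s) with hc
  set M : ℝ → ℝ := fun p => ∫ s in Ioi (0 : ℝ), s ^ (ν - 1) * Real.exp (p * (a - c s)) with hM
  have hMK : ∀ p, M p = Real.exp (a * p) * ∫ x in Ioi (0 : ℝ), gigKernel ν p (p * A) x := by
    intro p
    simp only [hM]
    rw [← integral_const_mul]
    refine integral_congr_ae (ae_of_all _ fun s => ?_)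
    simp only [gigKernel_scaled]
    rw [mul_left_comm, ← Real.exp_add]
    congr 2
    simp only [hc]
    ring
  have hA' := Real.sqrt_pos.2 hA
  -- On the open set `S`, where the exponent is within `ε / 2` of its minimum `√A`, the integrand
  -- of `M` grows exponentially.
  obtain ⟨q, hq, hlt⟩ : ∃ q, 1 < q ∧ M 1 < M q := by
    set S : Set ℝ := Ioi 0 ∩ {s | c s < Real.sqrt A + ε / 2} with hS
    have hcont : ContinuousOn c (Ioi 0) := by
      refine continuousOn_const.mul ((continuousOn_const.div continuousOn_id
        fun x hx => (ne_of_gt hx)).add (by fun_prop))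
    have hSo : IsOpen S := hcont.isOpen_inter_preimage isOpen_Ioi isOpen_Iio
    have hSne : S.Nonempty := by
      refine ⟨1 / Real.sqrt A, by simpa using hA', ?_⟩
      have : c (1 / Real.sqrt A) = Real.sqrt A := by
        simp only [hc]
        rw [one_div_one_div]
        nth_rewrite 2 [← Real.sq_sqrt hA.le]
        field_simp
        norm_num
      simp only [mem_ofPred_eq, this]
      linarith
    have hint1 : IntegrableOn (fun s => s ^ (ν - 1) * Real.exp (1 * (a - c s))) S :=
      (integrableOn_gigKernel_tilted ν a hA one_pos).mono_set inter_subset_left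
    have hSm : MeasurableSet S := hSo.measurableSet
    have hJ : 0 < ∫ s in S, s ^ (ν - 1) * Real.exp (1 * (a - c s)) := by
      have hp : ∀ s ∈ S, 0 < s ^ (ν - 1) * Real.exp (1 * (a - c s)) :=
        fun s hs => mul_pos (Real.rpow_pos_of_pos hs.1 _) (Real.exp_pos _)
      rw [setIntegral_pos_iff_support_of_nonneg_ae _ hint1]
      · refine lt_of_lt_of_le (hSo.measure_pos volume hSne)
          (measure_mono fun s hs => ⟨(hp s hs).ne', hs⟩)
      · exact (ae_restrict_iff' hSm).2 (Eventually.of_forall fun s hs => (hp s hs).le)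
    set J := ∫ s in S, s ^ (ν - 1) * Real.exp (1 * (a - c s))
    have hlow : ∀ q > 1, Real.exp (ε / 2 * (q - 1)) * J ≤ M q := by
      intro q hq
      have hq0 : (0 : ℝ) < q := by linarith
      have hiq := integrableOn_gigKernel_tilted ν a hA hq0
      calc Real.exp (ε / 2 * (q - 1)) * J
          ≤ ∫ s in S, s ^ (ν - 1) * Real.exp (q * (a - c s)) := by
            rw [← integral_const_mul]
            refine setIntegral_mono_on (hint1.const_mul _) (hiq.mono_set inter_subset_left)
              hSm fun s hs => ?_
            rw [mul_left_comm, ← Real.exp_add]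
            have h0 : (0 : ℝ) < s := hs.1
            have h1 : c s < Real.sqrt A + ε / 2 := hs.2
            gcongr
            nlinarith
        _ ≤ M q := by
            refine setIntegral_mono_set hiq ?_ inter_subset_left.eventuallyLE
            exact (ae_restrict_iff' measurableSet_Ioi).2 (Eventually.of_forall fun s hs =>
              (mul_pos (Real.rpow_pos_of_pos hs _) (Real.exp_pos _)).le)
    have htop : Tendsto (fun q : ℝ => Real.exp (ε / 2 * (q - 1)) * J) atTop atTop := by
      refine (Real.tendsto_exp_atTop.comp ?_).atTop_mul_const hJ
      exact (tendsto_atTop_add_const_right _ _ tendsto_id).const_mul_atTop (by positivity)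
    obtain ⟨q, h1, h2⟩ := ((htop.eventually_gt_atTop (M 1)).and (eventually_gt_atTop 1)).exists
    exact ⟨q, h2, h1.trans_le (hlow q h2)⟩
  have hmono := (convexOn_integral_gigKernel_tilted ν a hA).strictMonoOn
    (show (1 : ℝ) ∈ Ioi (0 : ℝ) by simp) hq hlt
  refine ⟨q, by linarith, fun x hx y hy => ?_⟩
  have hle : M x ≤ M y := hmono.monotoneOn ⟨show 0 < x by linarith, hx⟩
    ⟨show 0 < y by linarith, show q ≤ y by linarith⟩ hy
  rw [hMK, hMK] at hle
  have e : Real.exp (a * (y - x)) = Real.exp (a * y) / Real.exp (a * x) := by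
    rw [← Real.exp_sub]; congr 1; ring
  rw [e, div_mul_eq_mul_div, le_div_iff₀ (Real.exp_pos _)]
  linarith

/-- The power `p ^ ν` varies subexponentially. -/
theorem rpow_le_exp_mul_rpow (ν : ℝ) {ε p q : ℝ} (hε : 0 < ε) (hp : 0 < p) (hq : 0 < q)
    (hpν : |ν| / ε ≤ p) (hqν : |ν| / ε ≤ q) :
    q ^ ν ≤ Real.exp (ε * |q - p|) * p ^ ν := by
  have key : ∀ {x y : ℝ}, 0 < x → |ν| / ε ≤ x → x ≤ y →
      |ν| * (Real.log y - Real.log x) ≤ ε * (y - x) := by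
    intro x y hx h1 hxy
    have hy : 0 < y := hx.trans_le hxy
    have h2 : Real.log y - Real.log x ≤ y / x - 1 := by
      rw [← Real.log_div hy.ne' hx.ne']
      exact Real.log_le_sub_one_of_pos (div_pos hy hx)
    have h3 : |ν| ≤ ε * x := by rwa [div_le_iff₀ hε, mul_comm] at h1
    have h4 : y / x - 1 = (y - x) / x := by field_simp
    calc |ν| * (Real.log y - Real.log x) ≤ |ν| * ((y - x) / x) := by
          rw [← h4]; gcongr
      _ ≤ (ε * x) * ((y - x) / x) := by
          have : 0 ≤ (y - x) / x := div_nonneg (by linarith) hx.le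
          gcongr
      _ = ε * (y - x) := by field_simp
  have habs : |ν * (Real.log q - Real.log p)| ≤ ε * |q - p| := by
    rw [abs_mul]
    rcases le_total p q with h | h
    · rw [abs_of_nonneg (sub_nonneg.2 (Real.log_le_log hp h)), abs_of_nonneg (sub_nonneg.2 h)]
      exact key hp hpν h
    · rw [abs_sub_comm, abs_sub_comm q, abs_of_nonneg (sub_nonneg.2 (Real.log_le_log hq h)),
        abs_of_nonneg (sub_nonneg.2 h)]
      exact key hq hqν h
  rw [Real.rpow_def_of_pos hq, Real.rpow_def_of_pos hp, ← Real.exp_add, Real.exp_le_exp]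
  have := le_abs_self (ν * (Real.log q - Real.log p))
  linarith

/-- As a function of the square root of its first parameter, the normalizing integral of the
generalized inverse Gaussian density decays with rate `√A`. -/
theorem hasExpRate_integral_gigKernel (ν : ℝ) {A : ℝ} (hA : 0 < A) :
    HasExpRate (Real.sqrt A) fun p => ∫ x in Ioi (0 : ℝ), gigKernel ν (p ^ 2) A x := by
  intro ε hε
  obtain ⟨p₀, hp₀, h⟩ := exists_integral_gigKernel_scaled_le ν hA (half_pos hε)
  refine ⟨max p₀ (|ν| / (ε / 2)), fun p hp q hq => ?_⟩
  have hp1 : p₀ ≤ p := (le_max_left _ _).trans hp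
  have hq1 : p₀ ≤ q := (le_max_left _ _).trans hq
  have hp0 : 0 < p := hp₀.trans_le hp1
  have hq0 : 0 < q := hp₀.trans_le hq1
  have hpow := rpow_le_exp_mul_rpow ν (half_pos hε) hp0 hq0 ((le_max_right _ _).trans hp)
    ((le_max_right _ _).trans hq)
  simp only
  rw [integral_gigKernel_sq ν A hp0, integral_gigKernel_sq ν A hq0]
  have hK : ∫ x in Ioi (0 : ℝ), gigKernel ν q (q * A) x
      ≤ Real.exp (-Real.sqrt A * (q - p) + ε / 2 * |q - p|) *
        ∫ x in Ioi (0 : ℝ), gigKernel ν p (p * A) x := by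
    have hKp := (integral_gigKernel_pos ν hp0 (mul_pos hp0 hA)).le
    rcases le_total p q with hpq | hpq
    · refine (integral_gigKernel_scaled_le ν hA hp0 hpq).trans ?_
      gcongr
      have : 0 ≤ ε / 2 * |q - p| := by positivity
      linarith
    · refine (h q hq1 p hpq).trans (le_of_eq ?_)
      rw [abs_of_nonpos (by linarith)]
      congr 2
      ring
  have hKq := (integral_gigKernel_pos ν hq0 (mul_pos hq0 hA)).le
  calc _ ≤ (Real.exp (ε / 2 * |q - p|) * p ^ ν) *
        (Real.exp (-Real.sqrt A * (q - p) + ε / 2 * |q - p|) *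
        ∫ x in Ioi (0 : ℝ), gigKernel ν p (p * A) x) := by gcongr
    _ = _ := by
      rw [show -Real.sqrt A * (q - p) + ε * |q - p| = ε / 2 * |q - p| +
        (-Real.sqrt A * (q - p) + ε / 2 * |q - p|) by ring, Real.exp_add (ε / 2 * |q - p|)]
      ring

/-! ### Tail integrals of elliptically tilted densities on the plane -/

section TiltedDensity

open scoped RealInnerProductSpace

variable {E : Type*} [NormedAddCommGroup E] [InnerProductSpace ℝ E]

theorem inner_div_norm_le_norm_add_sub (w v : E) : ⟪w, v⟫ / ‖w‖ ≤ ‖w + v‖ - ‖w‖ := by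
  rcases eq_or_ne w 0 with rfl | hw
  · simp
  have hw' : 0 < ‖w‖ := norm_pos_iff.2 hw
  rw [div_le_iff₀ hw']
  have h := real_inner_le_norm w (w + v)
  rw [inner_add_right, real_inner_self_eq_norm_sq] at h
  linarith

theorem norm_add_sub_le_inner_div_norm (w v : E) : ‖w + v‖ - ‖w‖ ≤ ⟪w + v, v⟫ / ‖w + v‖ := by
  have h := inner_div_norm_le_norm_add_sub (w + v) (-v)
  rw [inner_neg_right, neg_div, add_neg_cancel_right] at h
  linarith

variable {ι : Type*} {l : Filter ι} {τ : ι → ℝ}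

theorem tendsto_inner_div_norm {w v : ι → E} {e u : E} (hτ : Tendsto τ l atTop)
    (hw : Tendsto (fun i => (τ i)⁻¹ • w i) l (𝓝 e)) (he : e ≠ 0) (hv : Tendsto v l (𝓝 u)) :
    Tendsto (fun i => ⟪w i, v i⟫ / ‖w i‖) l (𝓝 (⟪e, u⟫ / ‖e‖)) := by
  refine ((hw.inner hv).div hw.norm (norm_ne_zero_iff.2 he)).congr' ?_
  filter_upwards [hτ.eventually_gt_atTop 0] with i hi
  simp only [Pi.div_apply]
  rw [norm_smul, real_inner_smul_left, Real.norm_of_nonneg (inv_pos.2 hi).le]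
  exact mul_div_mul_left _ _ (inv_pos.2 hi).ne'

theorem tendsto_norm_add_sub_norm {w v : ι → E} {e u : E} (hτ : Tendsto τ l atTop)
    (hw : Tendsto (fun i => (τ i)⁻¹ • w i) l (𝓝 e)) (he : e ≠ 0) (hv : Tendsto v l (𝓝 u)) :
    Tendsto (fun i => ‖w i + v i‖ - ‖w i‖) l (𝓝 (⟪e, u⟫ / ‖e‖)) := by
  have hwv : Tendsto (fun i => (τ i)⁻¹ • (w i + v i)) l (𝓝 e) := by
    have := hw.add ((tendsto_inv_atTop_zero.comp hτ).smul hv)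
    simpa [smul_add] using this
  exact tendsto_of_tendsto_of_tendsto_of_le_of_le (tendsto_inner_div_norm hτ hw he hv)
    (tendsto_inner_div_norm hτ hwv he hv) (fun i => inner_div_norm_le_norm_add_sub _ _)
    (fun i => norm_add_sub_le_inner_div_norm _ _)

theorem tendsto_norm_atTop_of_tendsto_inv_smul {w : ι → E} {e : E} (hτ : Tendsto τ l atTop)
    (hw : Tendsto (fun i => (τ i)⁻¹ • w i) l (𝓝 e)) (he : e ≠ 0) :
    Tendsto (fun i => ‖w i‖) l atTop := by
  refine (hτ.atTop_mul_pos (norm_pos_iff.2 he) hw.norm).congr' ?_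
  filter_upwards [hτ.eventually_gt_atTop 0] with i hi
  rw [norm_smul, Real.norm_of_nonneg (inv_pos.2 hi).le, mul_inv_cancel_left₀ hi.ne']

/-- The unnormalized density `y ↦ exp (ℓ y) H(‖w₀ + M y‖)`: elliptical contours, tilted by the
exponential of a linear form. -/
noncomputable def tiltedDensity (H : ℝ → ℝ) (w₀ : E) (M : ℝ × ℝ →L[ℝ] E) (ℓ : ℝ × ℝ →L[ℝ] ℝ)
    (y : ℝ × ℝ) : ℝ :=
  Real.exp (ℓ y) * H ‖w₀ + M y‖

/-- The directional derivative at `m`, along `b`, of `y ↦ θ ‖M y‖ - ℓ y`. -/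
noncomputable def decayRate (θ : ℝ) (M : ℝ × ℝ →L[ℝ] E) (ℓ : ℝ × ℝ →L[ℝ] ℝ) (m b : ℝ × ℝ) : ℝ :=
  θ * (⟪M m, M b⟫ / ‖M m‖) - ℓ b

theorem decayRate_eq (θ : ℝ) (M : ℝ × ℝ →L[ℝ] E) (ℓ : ℝ × ℝ →L[ℝ] ℝ) (m b : ℝ × ℝ) :
    decayRate θ M ℓ m b = b.1 * decayRate θ M ℓ m (1, 0) + b.2 * decayRate θ M ℓ m (0, 1) := by
  have hb : b = b.1 • (1, 0) + b.2 • (0, 1) := by ext <;> simp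
  simp only [decayRate]
  conv_lhs => rw [hb]
  simp only [map_add, map_smul, inner_add_right, real_inner_smul_right, smul_eq_mul]
  ring

variable {H : ℝ → ℝ} {θ : ℝ} {w₀ : E} {M : ℝ × ℝ →L[ℝ] E} {ℓ : ℝ × ℝ →L[ℝ] ℝ} {m : ℝ × ℝ}
  {y : ι → ℝ × ℝ}

theorem tiltedDensity_pos (hH0 : ∀ p, 0 < H p) (x : ℝ × ℝ) : 0 < tiltedDensity H w₀ M ℓ x :=
  mul_pos (Real.exp_pos _) (hH0 _)

theorem measurable_tiltedDensity [MeasurableSpace E] [BorelSpace E] (hH : Measurable H) :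
    Measurable (tiltedDensity H w₀ M ℓ) := by
  unfold tiltedDensity
  have h1 : Measurable fun y : ℝ × ℝ => ‖w₀ + M y‖ :=
    (continuous_norm.comp (continuous_const.add M.continuous)).measurable
  have h2 : Measurable fun y : ℝ × ℝ => Real.exp (ℓ y) :=
    (Real.continuous_exp.comp ℓ.continuous).measurable
  exact h2.mul (hH.comp h1)

theorem tendsto_inv_smul_add_map (hτ : Tendsto τ l atTop)
    (hy : Tendsto (fun i => (τ i)⁻¹ • y i) l (𝓝 m)) :
    Tendsto (fun i => (τ i)⁻¹ • (w₀ + M (y i))) l (𝓝 (M m)) := by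
  have h1 := (tendsto_inv_atTop_zero.comp hτ).smul_const w₀
  have h2 := (M.continuous.tendsto m).comp hy
  have := h1.add h2
  simpa [smul_add] using this

theorem tendsto_tiltedDensity_div (hH : HasExpRate θ H) (hH0 : ∀ p, 0 < H p) (hMm : M m ≠ 0)
    (hτ : Tendsto τ l atTop) (hy : Tendsto (fun i => (τ i)⁻¹ • y i) l (𝓝 m))
    {b : ι → ℝ × ℝ} {b₀ : ℝ × ℝ} (hb : Tendsto b l (𝓝 b₀)) :
    Tendsto (fun i => tiltedDensity H w₀ M ℓ (b i + y i) / tiltedDensity H w₀ M ℓ (y i)) l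
      (𝓝 (Real.exp (-decayRate θ M ℓ m b₀))) := by
  have hw := tendsto_inv_smul_add_map (w₀ := w₀) (M := M) hτ hy
  have hMb := (M.continuous.tendsto b₀).comp hb
  have h1 := hH.tendsto_div hH0 (tendsto_norm_atTop_of_tendsto_inv_smul hτ hw hMm)
    (tendsto_norm_add_sub_norm hτ hw hMm hMb)
  have h2 : Tendsto (fun i => Real.exp (ℓ (b i))) l (𝓝 (Real.exp (ℓ b₀))) :=
    (Real.continuous_exp.tendsto _).comp ((ℓ.continuous.tendsto _).comp hb)
  have h3 := h2.mul h1
  rw [← Real.exp_add] at h3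
  have e : ℓ b₀ + -θ * (⟪M m, M b₀⟫ / ‖M m‖) = -decayRate θ M ℓ m b₀ := by
    simp only [decayRate]; ring
  rw [e] at h3
  refine h3.congr fun i => ?_
  simp only [tiltedDensity, Function.comp_apply, map_add]
  rw [show w₀ + (M (b i) + M (y i)) = w₀ + M (y i) + M (b i) by abel, Real.exp_add]
  have := (hH0 ‖w₀ + M (y i)‖).ne'
  field_simp

/-- Exponential domination over the whole quadrant. It rests on the convexity of the norm, which
bounds the increments of `‖w₀ + M y‖` below by its derivative at the corner. -/
theorem eventually_tiltedDensity_le (hH : HasExpRate θ H) (hH0 : ∀ p, 0 < H p) (hθ : 0 ≤ θ)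
    (hMm : M m ≠ 0) {c : ℝ} (hc : ∀ x : ℝ × ℝ, x.1 - c ≤ ‖w₀ + M x‖)
    {δ : ℝ} (hδ : 0 < δ) (h1 : 2 * δ ≤ decayRate θ M ℓ m (1, 0))
    (h2 : 2 * δ ≤ decayRate θ M ℓ m (0, 1)) (hm : 0 < m.1)
    (hτ : Tendsto τ l atTop) (hy : Tendsto (fun i => (τ i)⁻¹ • y i) l (𝓝 m)) :
    ∀ᶠ i in l, ∀ a : ℝ × ℝ, 0 < a.1 → 0 < a.2 →
      tiltedDensity H w₀ M ℓ (a + y i)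
        ≤ Real.exp (-δ * (a.1 + a.2)) * tiltedDensity H w₀ M ℓ (y i) := by
  have hw := tendsto_inv_smul_add_map (w₀ := w₀) (M := M) hτ hy
  have hy1 : Tendsto (fun i => (y i).1) l atTop := by
    have h := (continuous_fst.tendsto m).comp hy
    refine (hτ.atTop_mul_pos hm h).congr' ?_
    filter_upwards [hτ.eventually_gt_atTop 0] with i hi
    simp [mul_inv_cancel_left₀ hi.ne']
  set K := ‖M (1, 0)‖ + ‖M (0, 1)‖ with hK
  have hK0 : 0 ≤ K := by positivity
  set ε := δ / (2 * (K + 1)) with hε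
  have hε0 : 0 < ε := by positivity
  have hεK : ε * K ≤ δ / 2 := by
    have : ε * (K + 1) = δ / 2 := by rw [hε]; field_simp
    nlinarith
  obtain ⟨p₀, hp₀⟩ := hH ε hε0
  -- The decay rate at the point `w₀ + M (y i)` instead of its limit `M m`.
  have hlim : ∀ b : ℝ × ℝ, 2 * δ ≤ decayRate θ M ℓ m b → ∀ᶠ i in l,
      3 / 2 * δ ≤ θ * (⟪w₀ + M (y i), M b⟫ / ‖w₀ + M (y i)‖) - ℓ b := by
    intro b hb
    have := ((tendsto_inner_div_norm hτ hw hMm (tendsto_const_nhds (x := M b))).const_mul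
      θ).sub_const (ℓ b)
    exact (this.eventually_const_lt (by unfold decayRate at hb; linarith)).mono fun i hi => hi.le
  filter_upwards [hlim _ h1, hlim _ h2, hy1.eventually_ge_atTop (p₀ + c)] with i hi1 hi2 hi3
  intro a ha1 ha2
  set w := w₀ + M (y i) with hwdef
  have hMa : M a = a.1 • M (1, 0) + a.2 • M (0, 1) := by
    rw [← map_smul, ← map_smul, ← map_add]
    congr 1
    ext <;> simp
  have hℓa : ℓ a = a.1 * ℓ (1, 0) + a.2 * ℓ (0, 1) := by
    rw [← smul_eq_mul, ← smul_eq_mul, ← map_smul, ← map_smul, ← map_add]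
    congr 1
    ext <;> simp
  have hwa : w₀ + M (a + y i) = w + M a := by rw [map_add, hwdef]; abel
  have hnw : p₀ ≤ ‖w‖ := le_trans (by linarith) (hc (y i))
  have hnwa : p₀ ≤ ‖w + M a‖ := by
    rw [← hwa]
    refine le_trans ?_ (hc (a + y i))
    rw [Prod.fst_add]
    linarith
  have hH' := hp₀ _ hnw _ hnwa
  have hlow := inner_div_norm_le_norm_add_sub w (M a)
  have hup : |‖w + M a‖ - ‖w‖| ≤ (a.1 + a.2) * K := by
    have t1 := abs_norm_sub_norm_le (w + M a) w
    rw [add_sub_cancel_left] at t1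
    refine t1.trans ?_
    rw [hMa]
    refine (norm_add_le _ _).trans ?_
    rw [norm_smul, norm_smul, Real.norm_of_nonneg ha1.le, Real.norm_of_nonneg ha2.le, hK]
    nlinarith [norm_nonneg (M (1, 0)), norm_nonneg (M (0, 1))]
  simp only [tiltedDensity]
  rw [hwa, map_add, Real.exp_add, ← hwdef]
  have hexp : ℓ a + (-θ * (‖w + M a‖ - ‖w‖) + ε * |‖w + M a‖ - ‖w‖|) ≤ -δ * (a.1 + a.2) := by
    have e1 : ε * |‖w + M a‖ - ‖w‖| ≤ (a.1 + a.2) * (δ / 2) := by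
      calc _ ≤ ε * ((a.1 + a.2) * K) := by gcongr
        _ = (a.1 + a.2) * (ε * K) := by ring
        _ ≤ _ := by gcongr
    have e2 : θ * (⟪w, M a⟫ / ‖w‖) ≤ θ * (‖w + M a‖ - ‖w‖) := by gcongr
    have e3 : ⟪w, M a⟫ / ‖w‖ = a.1 * (⟪w, M (1, 0)⟫ / ‖w‖) + a.2 * (⟪w, M (0, 1)⟫ / ‖w‖) := by
      rw [hMa, inner_add_right, real_inner_smul_right, real_inner_smul_right]
      ring
    have e4 := mul_le_mul_of_nonneg_left hi1 ha1.le
    have e5 := mul_le_mul_of_nonneg_left hi2 ha2.le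
    rw [e3] at e2
    rw [hℓa]
    nlinarith
  calc Real.exp (ℓ a) * Real.exp (ℓ (y i)) * H ‖w + M a‖
      ≤ Real.exp (ℓ a) * Real.exp (ℓ (y i)) *
        (Real.exp (-θ * (‖w + M a‖ - ‖w‖) + ε * |‖w + M a‖ - ‖w‖|) * H ‖w‖) := by gcongr
    _ = Real.exp (ℓ a + (-θ * (‖w + M a‖ - ‖w‖) + ε * |‖w + M a‖ - ‖w‖|)) *
        (Real.exp (ℓ (y i)) * H ‖w‖) := by rw [Real.exp_add (ℓ a)]; ring
    _ ≤ _ := by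
        have := (hH0 ‖w‖).le
        gcongr

theorem integrableOn_quadrant_exp {c₁ c₂ : ℝ} (h1 : 0 < c₁) (h2 : 0 < c₂) :
    IntegrableOn (fun a : ℝ × ℝ => Real.exp (-(a.1 * c₁ + a.2 * c₂))) (Ioi 0 ×ˢ Ioi 0) := by
  have h := (exp_neg_integrableOn_Ioi 0 h1).mul_prod (exp_neg_integrableOn_Ioi 0 h2)
  rw [Measure.prod_restrict] at h
  refine h.congr (ae_of_all _ fun a => ?_)
  simp only
  rw [← Real.exp_add]
  congr 1
  ring

/-- The integral of a tilted density over a quadrant is asymptotically a fixed multiple of its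
value at the corner. -/
theorem tendsto_integral_quadrant_div [MeasurableSpace E] [BorelSpace E] [l.IsCountablyGenerated]
    (hHm : Measurable H) (hH : HasExpRate θ H) (hH0 : ∀ p, 0 < H p) (hθ : 0 ≤ θ)
    (hMm : M m ≠ 0) {c : ℝ} (hc : ∀ x : ℝ × ℝ, x.1 - c ≤ ‖w₀ + M x‖)
    (h1 : 0 < decayRate θ M ℓ m (1, 0)) (h2 : 0 < decayRate θ M ℓ m (0, 1)) (hm : 0 < m.1)
    (hτ : Tendsto τ l atTop) (hy : Tendsto (fun i => (τ i)⁻¹ • y i) l (𝓝 m)) :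
    Tendsto (fun i => (∫ a in Ioi (0 : ℝ) ×ˢ Ioi (0 : ℝ), tiltedDensity H w₀ M ℓ (a + y i)) /
      tiltedDensity H w₀ M ℓ (y i)) l
      (𝓝 (∫ a in Ioi (0 : ℝ) ×ˢ Ioi (0 : ℝ), Real.exp (-decayRate θ M ℓ m a))) := by
  obtain ⟨δ, hδ, hδ1, hδ2⟩ : ∃ δ > 0, 2 * δ ≤ decayRate θ M ℓ m (1, 0) ∧
      2 * δ ≤ decayRate θ M ℓ m (0, 1) :=
    ⟨min (decayRate θ M ℓ m (1, 0)) (decayRate θ M ℓ m (0, 1)) / 2, half_pos (lt_min h1 h2),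
      by rw [mul_div_cancel₀ _ two_ne_zero]; exact min_le_left _ _,
      by rw [mul_div_cancel₀ _ two_ne_zero]; exact min_le_right _ _⟩
  have hdom := eventually_tiltedDensity_le hH hH0 hθ hMm hc hδ hδ1 hδ2 hm hτ hy
  have hms : MeasurableSet (Ioi (0 : ℝ) ×ˢ Ioi (0 : ℝ)) := measurableSet_Ioi.prod measurableSet_Ioi
  simp only [← integral_div]
  refine tendsto_integral_filter_of_dominated_convergence
    (fun a => Real.exp (-(a.1 * δ + a.2 * δ))) ?_ ?_ (integrableOn_quadrant_exp hδ hδ) ?_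
  · refine Eventually.of_forall fun i => Measurable.aestronglyMeasurable ?_
    exact ((measurable_tiltedDensity hHm).comp (measurable_id.add_const _)).div_const _
  · filter_upwards [hdom] with i hi
    refine (ae_restrict_iff' hms).2 (Eventually.of_forall fun a ha => ?_)
    rw [Real.norm_of_nonneg (div_pos (tiltedDensity_pos hH0 _) (tiltedDensity_pos hH0 _)).le,
      div_le_iff₀ (tiltedDensity_pos hH0 _)]
    have := hi a ha.1 ha.2
    rwa [show -δ * (a.1 + a.2) = -(a.1 * δ + a.2 * δ) by ring] at this
  · refine Eventually.of_forall fun a => ?_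
    exact tendsto_tiltedDensity_div hH hH0 hMm hτ hy tendsto_const_nhds

/-- Bounded shifts of the corner of a quadrant change the integral of a tilted density by an
exponential factor in the limit. -/
theorem tendsto_integral_quadrant_shift_div [MeasurableSpace E] [BorelSpace E]
    [l.IsCountablyGenerated]
    (hHm : Measurable H) (hH : HasExpRate θ H) (hH0 : ∀ p, 0 < H p) (hθ : 0 ≤ θ)
    (hMm : M m ≠ 0) {c : ℝ} (hc : ∀ x : ℝ × ℝ, x.1 - c ≤ ‖w₀ + M x‖)
    (h1 : 0 < decayRate θ M ℓ m (1, 0)) (h2 : 0 < decayRate θ M ℓ m (0, 1)) (hm : 0 < m.1)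
    (hτ : Tendsto τ l atTop) (hy : Tendsto (fun i => (τ i)⁻¹ • y i) l (𝓝 m))
    {b : ι → ℝ × ℝ} {b₀ : ℝ × ℝ} (hb : Tendsto b l (𝓝 b₀)) :
    Tendsto (fun i =>
      (∫ a in Ioi (0 : ℝ) ×ˢ Ioi (0 : ℝ), tiltedDensity H w₀ M ℓ (a + (b i + y i))) /
        ∫ a in Ioi (0 : ℝ) ×ˢ Ioi (0 : ℝ), tiltedDensity H w₀ M ℓ (a + y i)) l
      (𝓝 (Real.exp (-decayRate θ M ℓ m b₀))) := by
  have hyb : Tendsto (fun i => (τ i)⁻¹ • (b i + y i)) l (𝓝 m) := by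
    have := ((tendsto_inv_atTop_zero.comp hτ).smul hb).add hy
    simpa [smul_add] using this
  set I := ∫ a in Ioi (0 : ℝ) ×ˢ Ioi (0 : ℝ), Real.exp (-decayRate θ M ℓ m a) with hI
  have hI0 : 0 < I := by
    rw [hI]
    rw [show (fun a => Real.exp (-decayRate θ M ℓ m a)) = fun a : ℝ × ℝ =>
      Real.exp (-(a.1 * decayRate θ M ℓ m (1, 0) + a.2 * decayRate θ M ℓ m (0, 1))) from
      funext fun a => by rw [decayRate_eq]]
    rw [setIntegral_pos_iff_support_of_nonneg_ae (ae_of_all _ fun a => (Real.exp_pos _).le)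
      (integrableOn_quadrant_exp h1 h2)]
    refine lt_of_lt_of_le ?_ (measure_mono fun a ha => ⟨(Real.exp_pos _).ne', ha⟩)
    exact (isOpen_Ioi.prod isOpen_Ioi).measure_pos _ ⟨(1, 1), by simp⟩
  have t1 := tendsto_integral_quadrant_div hHm hH hH0 hθ hMm hc h1 h2 hm hτ hy
  have t2 := tendsto_integral_quadrant_div hHm hH hH0 hθ hMm hc h1 h2 hm hτ hyb
  have t3 := tendsto_tiltedDensity_div (w₀ := w₀) (ℓ := ℓ) hH hH0 hMm hτ hy hb
  have t4 := (t2.div t1 hI0.ne').mul t3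
  rw [div_self hI0.ne', one_mul] at t4
  refine t4.congr fun i => ?_
  have p1 := (tiltedDensity_pos (w₀ := w₀) (M := M) (ℓ := ℓ) hH0 (y i)).ne'
  have p2 := (tiltedDensity_pos (w₀ := w₀) (M := M) (ℓ := ℓ) hH0 (b i + y i)).ne'
  simp only [Pi.div_apply]
  field_simp

end TiltedDensity

/-! ### Radial factors and one-dimensional densities -/

namespace HasExpRate

variable {θ : ℝ} {φ : ℝ → ℝ}

theorem congr {φ' : ℝ → ℝ} (h : HasExpRate θ φ) (he : φ =ᶠ[atTop] φ') : HasExpRate θ φ' := by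
  intro ε hε
  obtain ⟨x₀, hx₀⟩ := h ε hε
  obtain ⟨x₁, hx₁⟩ := eventually_atTop.1 he
  refine ⟨max x₀ x₁, fun x hx y hy => ?_⟩
  rw [← hx₁ x ((le_max_right _ _).trans hx), ← hx₁ y ((le_max_right _ _).trans hy)]
  exact hx₀ x ((le_max_left _ _).trans hx) y ((le_max_left _ _).trans hy)

theorem const_mul (h : HasExpRate θ φ) {c : ℝ} (hc : 0 ≤ c) :
    HasExpRate θ fun x => c * φ x := by
  intro ε hε
  obtain ⟨x₀, hx₀⟩ := h ε hε
  refine ⟨x₀, fun x hx y hy => ?_⟩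
  rw [mul_left_comm]
  exact mul_le_mul_of_nonneg_left (hx₀ x hx y hy) hc

theorem exp_mul (h : HasExpRate θ φ) (γ : ℝ) :
    HasExpRate (θ - γ) fun x => Real.exp (γ * x) * φ x := by
  intro ε hε
  obtain ⟨x₀, hx₀⟩ := h ε hε
  refine ⟨x₀, fun x hx y hy => ?_⟩
  refine (mul_le_mul_of_nonneg_left (hx₀ x hx y hy) (Real.exp_pos (γ * y)).le).trans (le_of_eq ?_)
  rw [← mul_assoc, ← mul_assoc, ← Real.exp_add, ← Real.exp_add]
  congr 2
  ring

/-- Composition with `x ↦ √(κ + (x - μ)²)`, whose derivative tends to `1`, preserves the rate. -/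
theorem comp_sqrt (h : HasExpRate θ φ) (hpos : ∀ x, 0 < φ x) {κ : ℝ} (hκ : 0 ≤ κ) (μ : ℝ) :
    HasExpRate θ fun x => φ (Real.sqrt (κ + (x - μ) ^ 2)) := by
  intro ε hε
  obtain ⟨p₀, hp₀⟩ := h (ε / 2) (half_pos hε)
  set ε' := ε / (2 * (|θ| + ε)) with hε'
  have hden : 0 < |θ| + ε := by positivity
  have hε'0 : 0 < ε' := by positivity
  have hle : ε' * (|θ| + ε) = ε / 2 := by rw [hε']; field_simp
  -- The constant is such that `√(κ + t²) - t ≤ κ / t ≤ ε' t` for `t ≥ t₀`.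
  set t₀ := max (max p₀ 1) (κ / ε') with ht₀
  have hsq : ∀ t ≥ t₀, t ≤ Real.sqrt (κ + t ^ 2) ∧
      Real.sqrt (κ + t ^ 2) - t ≤ ε' * Real.sqrt (κ + t ^ 2) := by
    intro t ht
    have ht1 : 1 ≤ t := ((le_max_right p₀ 1).trans (le_max_left _ _)).trans ht
    have h1 : t ≤ Real.sqrt (κ + t ^ 2) := Real.le_sqrt_of_sq_le (by linarith)
    refine ⟨h1, ?_⟩
    have hκt : κ ≤ ε' * t := by
      have := (le_max_right (max p₀ 1) (κ / ε')).trans ht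
      rwa [div_le_iff₀ hε'0, mul_comm] at this
    have h2 := Real.sq_sqrt (show 0 ≤ κ + t ^ 2 by positivity)
    set s := Real.sqrt (κ + t ^ 2)
    have h3 : (s - t) * s ≤ (ε' * s) * s := by
      have : (s - t) * s ≤ (s - t) * (s + t) := by
        apply mul_le_mul_of_nonneg_left <;> linarith
      nlinarith
    exact le_of_mul_le_mul_right h3 (by linarith)
  refine ⟨t₀ + μ, fun x hx y hy => ?_⟩
  obtain ⟨hx1, hx2⟩ := hsq (x - μ) (by linarith)
  obtain ⟨hy1, hy2⟩ := hsq (y - μ) (by linarith)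
  have ht1 : 1 ≤ t₀ := (le_max_right p₀ 1).trans (le_max_left _ _)
  have htp : p₀ ≤ t₀ := (le_max_left p₀ 1).trans (le_max_left _ _)
  have h1 := Real.sq_sqrt (show 0 ≤ κ + (x - μ) ^ 2 by positivity)
  have h2 := Real.sq_sqrt (show 0 ≤ κ + (y - μ) ^ 2 by positivity)
  simp only
  set p := Real.sqrt (κ + (x - μ) ^ 2)
  set q := Real.sqrt (κ + (y - μ) ^ 2)
  have hpq : 0 < p + q := by linarith
  have hd : |(q - p) - (y - x)| ≤ ε' * |y - x| := by
    have e : ((q - p) - (y - x)) * (p + q) = (y - x) * ((x - μ) + (y - μ) - (p + q)) := by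
      nlinarith
    refine le_of_mul_le_mul_right ?_ hpq
    rw [← abs_of_pos hpq, ← abs_mul, abs_of_pos hpq, e, abs_mul,
      abs_of_nonpos (show (x - μ) + (y - μ) - (p + q) ≤ 0 by linarith)]
    nlinarith [abs_nonneg (y - x)]
  have hε'1 : ε' ≤ 1 := by
    rw [hε', div_le_one (by positivity)]
    linarith [abs_nonneg θ]
  have hqp : |q - p| ≤ (1 + ε') * |y - x| := by
    have := abs_add_le ((q - p) - (y - x)) (y - x)
    rw [sub_add_cancel] at this
    linarith
  refine (hp₀ p (by linarith) q (by linarith)).trans ?_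
  refine mul_le_mul_of_nonneg_right (Real.exp_le_exp.2 ?_) (hpos p).le
  have e1 : -θ * (q - p) ≤ -θ * (y - x) + |θ| * (ε' * |y - x|) := by
    have : -θ * ((q - p) - (y - x)) ≤ |θ| * |(q - p) - (y - x)| := by
      rw [← abs_neg θ, ← abs_mul]; exact le_abs_self _
    have := mul_le_mul_of_nonneg_left hd (abs_nonneg θ)
    linarith
  have e2 := mul_le_mul_of_nonneg_left hqp (half_pos hε).le
  have e3 : |θ| * (ε' * |y - x|) + ε / 2 * ((1 + ε') * |y - x|) ≤ ε * |y - x| := by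
    have hz := abs_nonneg (y - x)
    have : |θ| * ε' + ε / 2 * (1 + ε') ≤ ε := by nlinarith [abs_nonneg θ]
    nlinarith
  linarith

end HasExpRate

/-- The normalizing integral of the generalized inverse Gaussian density as a function of the
square root of its first parameter. The value at `0`, where the integral may diverge, is set to `1`
in order to have a function that is positive everywhere. -/
noncomputable def radialFactor (ν A p : ℝ) : ℝ :=
  if p = 0 then 1 else ∫ x in Ioi (0 : ℝ), gigKernel ν (p ^ 2) A x

theorem radialFactor_pos (ν : ℝ) {A : ℝ} (hA : 0 < A) (p : ℝ) : 0 < radialFactor ν A p := by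
  unfold radialFactor
  split_ifs with h
  · exact one_pos
  · exact integral_gigKernel_pos ν (by positivity) hA

theorem measurable_radialFactor (ν A : ℝ) : Measurable (radialFactor ν A) := by
  refine Measurable.ite (measurableSet_singleton 0) measurable_const ?_
  have : Measurable (Function.uncurry fun p x : ℝ => gigKernel ν (p ^ 2) A x) := by
    unfold gigKernel Function.uncurry; fun_prop
  exact (this.stronglyMeasurable.integral_prod_right).measurable

theorem hasExpRate_radialFactor (ν : ℝ) {A : ℝ} (hA : 0 < A) :
    HasExpRate (Real.sqrt A) (radialFactor ν A) := by
  refine (hasExpRate_integral_gigKernel ν hA).congr ?_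
  filter_upwards [eventually_ne_atTop 0] with p hp
  rw [radialFactor, if_neg hp]

/-- The density of the one-dimensional generalized hyperbolic law, up to a constant factor. -/
noncomputable def ghDensity₁ (lam κ ψ γ μ x : ℝ) : ℝ :=
  Real.exp (γ * x) * radialFactor (lam - 1 / 2) (ψ + γ ^ 2) (Real.sqrt (κ + (x - μ) ^ 2))

theorem ghDensity₁_pos (lam κ γ μ x : ℝ) {ψ : ℝ} (hψ : 0 < ψ) :
    0 < ghDensity₁ lam κ ψ γ μ x :=
  mul_pos (Real.exp_pos _) (radialFactor_pos _ (by positivity) _)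

theorem measurable_ghDensity₁ (lam κ ψ γ μ : ℝ) : Measurable (ghDensity₁ lam κ ψ γ μ) := by
  have := (measurable_radialFactor (lam - 1 / 2) (ψ + γ ^ 2)).comp
    (show Measurable fun x : ℝ => Real.sqrt (κ + (x - μ) ^ 2) by fun_prop)
  exact (show Measurable fun x : ℝ => Real.exp (γ * x) by fun_prop).mul this

theorem hasExpRate_ghDensity₁ (lam γ μ : ℝ) {κ ψ : ℝ} (hκ : 0 ≤ κ) (hψ : 0 < ψ) :
    HasExpRate (Real.sqrt (ψ + γ ^ 2) - γ) (ghDensity₁ lam κ ψ γ μ) :=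
  have hA : 0 < ψ + γ ^ 2 := by positivity
  ((hasExpRate_radialFactor _ hA).comp_sqrt (radialFactor_pos _ hA) hκ μ).exp_mul γ

/-! ### The decay rates of the bivariate law -/

section Rates

theorem one_sub_sq_pos {ρ : ℝ} (hρ : |ρ| < 1) : 0 < 1 - ρ ^ 2 := by
  have := (sq_lt_one_iff_abs_lt_one ρ).2 hρ
  linarith

theorem quad_form_pos {ρ a b : ℝ} (hρ : |ρ| < 1) (h : 0 < a) :
    0 < a ^ 2 - 2 * ρ * a * b + b ^ 2 := by
  have h1 : ρ ^ 2 < 1 := (sq_lt_one_iff_abs_lt_one ρ).2 hρ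
  have : a ^ 2 - 2 * ρ * a * b + b ^ 2 = (1 - ρ ^ 2) * a ^ 2 + (b - ρ * a) ^ 2 := by ring
  rw [this]
  have : 0 < (1 - ρ ^ 2) * a ^ 2 := mul_pos (by linarith) (by positivity)
  positivity

theorem quad_form_nonneg {ρ : ℝ} (a b : ℝ) (hρ : |ρ| < 1) :
    0 ≤ a ^ 2 - 2 * ρ * a * b + b ^ 2 := by
  have h1 : ρ ^ 2 < 1 := (sq_lt_one_iff_abs_lt_one ρ).2 hρ
  nlinarith [sq_nonneg (b - ρ * a), sq_nonneg a]

variable {ψ γ m : ℝ}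

theorem marginal_scale_pos (hψ : 0 < ψ) (hm : m = (γ + Real.sqrt (ψ + γ ^ 2)) / ψ) : 0 < m := by
  have h : |γ| < Real.sqrt (ψ + γ ^ 2) := by
    rw [← Real.sqrt_sq_eq_abs]
    exact Real.sqrt_lt_sqrt (sq_nonneg _) (by linarith)
  rw [hm]
  have := neg_abs_le γ
  exact div_pos (by linarith) hψ

theorem marginal_scale_quadratic (hψ : 0 < ψ) (hm : m = (γ + Real.sqrt (ψ + γ ^ 2)) / ψ) :
    2 * γ * m = ψ * m ^ 2 - 1 := by
  have h := Real.sq_sqrt (show 0 ≤ ψ + γ ^ 2 by positivity)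
  have h2 : ψ * m - γ = Real.sqrt (ψ + γ ^ 2) := by rw [hm]; field_simp; ring
  rw [← h2] at h
  have : ψ * (2 * γ * m) = ψ * (ψ * m ^ 2 - 1) := by nlinarith
  exact mul_left_cancel₀ hψ.ne' this

theorem inv_marginal_scale (hψ : 0 < ψ) (hm : m = (γ + Real.sqrt (ψ + γ ^ 2)) / ψ) :
    m⁻¹ = Real.sqrt (ψ + γ ^ 2) - γ := by
  have h := marginal_scale_quadratic hψ hm
  have hm0 := marginal_scale_pos hψ hm
  have h2 : ψ * m - γ = Real.sqrt (ψ + γ ^ 2) := by rw [hm]; field_simp; ring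
  rw [← h2, inv_eq_one_div, div_eq_iff hm0.ne']
  linarith

/-- `t ↦ t / √(t² + k²)` is strictly increasing. -/
theorem mul_sqrt_lt_mul_sqrt {a b c k : ℝ} (hb : 0 < b) (hk : 0 < k) (h : c * b < a * k) :
    c * Real.sqrt (a ^ 2 + b ^ 2) < a * Real.sqrt (c ^ 2 + k ^ 2) := by
  have hs1 : 0 < Real.sqrt (a ^ 2 + b ^ 2) := Real.sqrt_pos.2 (by positivity)
  have hs2 : 0 < Real.sqrt (c ^ 2 + k ^ 2) := Real.sqrt_pos.2 (by positivity)
  have e1 := Real.sq_sqrt (show 0 ≤ a ^ 2 + b ^ 2 by positivity)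
  have e2 := Real.sq_sqrt (show 0 ≤ c ^ 2 + k ^ 2 by positivity)
  set s := Real.sqrt (a ^ 2 + b ^ 2)
  set t := Real.sqrt (c ^ 2 + k ^ 2)
  have hdiff : (a * t) ^ 2 - (c * s) ^ 2 = (a * k) ^ 2 - (c * b) ^ 2 := by
    rw [mul_pow, mul_pow, e1, e2]; ring
  rcases le_or_gt c 0 with hc | hc
  · rcases lt_or_ge 0 a with ha | ha
    · exact (mul_nonpos_of_nonpos_of_nonneg hc hs1.le).trans_lt (mul_pos ha hs2)
    · -- Both sides are nonpositive.
      have h1 : (a * k) ^ 2 < (c * b) ^ 2 := by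
        have : a * k ≤ 0 := mul_nonpos_of_nonpos_of_nonneg ha hk.le
        nlinarith
      have h2 : a * t ≤ 0 := mul_nonpos_of_nonpos_of_nonneg ha hs2.le
      have h3 : c * s ≤ 0 := mul_nonpos_of_nonpos_of_nonneg hc hs1.le
      nlinarith
  · have hcb : 0 < c * b := mul_pos hc hb
    have ha : 0 < a := pos_of_mul_pos_left (hcb.trans h) hk.le
    have h1 : (c * b) ^ 2 < (a * k) ^ 2 := by nlinarith
    exact lt_of_pow_lt_pow_left₀ 2 (by positivity) (by linarith)

variable {γ₁ γ₂ m₁ m₂ ρ : ℝ}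

/-- The gradient of the bivariate rate function `y ↦ √A ‖y‖ - ⟪γ, y⟫` at `(m₁, m₂)` has a positive
first component: along the line `y₂ = m₂` the rate function is convex, and its minimum is at
`y₁ = (γ₁ m₂ + ρ) / √(ψ + γ₂²) < m₁`. -/
theorem corner_rate_pos (hψ : 0 < ψ) (hρ : |ρ| < 1)
    (hm₁ : m₁ = (γ₁ + Real.sqrt (ψ + γ₁ ^ 2)) / ψ)
    (hm₂ : m₂ = (γ₂ + Real.sqrt (ψ + γ₂ ^ 2)) / ψ) :
    0 < Real.sqrt (ψ + (γ₁ ^ 2 - 2 * ρ * γ₁ * γ₂ + γ₂ ^ 2) / (1 - ρ ^ 2)) *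
      ((m₁ - ρ * m₂) / (1 - ρ ^ 2) /
        Real.sqrt ((m₁ ^ 2 - 2 * ρ * m₁ * m₂ + m₂ ^ 2) / (1 - ρ ^ 2)))
      - (γ₁ - ρ * γ₂) / (1 - ρ ^ 2) := by
  have hD := one_sub_sq_pos hρ
  have p1 := marginal_scale_pos hψ hm₁
  have p2 := marginal_scale_pos hψ hm₂
  have q1 := marginal_scale_quadratic hψ hm₁
  have q2 := marginal_scale_quadratic hψ hm₂
  have hs2 : 0 < Real.sqrt (ψ + γ₂ ^ 2) := Real.sqrt_pos.2 (by positivity)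
  have e2 := Real.sq_sqrt (show 0 ≤ ψ + γ₂ ^ 2 by positivity)
  have hsm : Real.sqrt (ψ + γ₂ ^ 2) = ψ * m₂ - γ₂ := by rw [hm₂]; field_simp; ring
  set s := Real.sqrt (ψ + γ₂ ^ 2)
  have hmin : γ₁ * m₂ + ρ < m₁ * s := by
    have h := quad_form_pos (b := m₂) hρ p1
    rw [hsm]
    have : 0 < 2 * m₁ * m₂ * (m₁ * (ψ * m₂ - γ₂) - (γ₁ * m₂ + ρ)) := by
      have e : 2 * m₁ * m₂ * (m₁ * (ψ * m₂ - γ₂) - (γ₁ * m₂ + ρ))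
        = 2 * ψ * m₁ ^ 2 * m₂ ^ 2 - m₁ ^ 2 * (2 * γ₂ * m₂) - m₂ ^ 2 * (2 * γ₁ * m₁)
          - 2 * ρ * m₁ * m₂ := by ring
      rw [e, q1, q2]
      nlinarith
    have := pos_of_mul_pos_right this (by positivity)
    linarith
  have hrD : 0 < Real.sqrt (1 - ρ ^ 2) := Real.sqrt_pos.2 hD
  have eD := Real.sq_sqrt hD.le
  set d := Real.sqrt (1 - ρ ^ 2)
  -- Both quadratic forms are sums of two squares, the second one being `(d m₂)²` or `(d s)²`.
  have key := mul_sqrt_lt_mul_sqrt (a := m₁ - ρ * m₂) (b := d * m₂) (c := γ₁ - ρ * γ₂)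
    (k := d * s) (by positivity) (by positivity) (by
      have : (γ₁ - ρ * γ₂) * m₂ < (m₁ - ρ * m₂) * s := by
        have h1 : ρ * (s * m₂ - γ₂ * m₂) = ρ * 1 := by congr 1; rw [hsm]; linarith
        linarith
      nlinarith)
  have f1 : (m₁ ^ 2 - 2 * ρ * m₁ * m₂ + m₂ ^ 2) / (1 - ρ ^ 2)
      = ((m₁ - ρ * m₂) ^ 2 + (d * m₂) ^ 2) / d ^ 2 := by
    rw [mul_pow, eD]; congr 1; ring
  have f2 : ψ + (γ₁ ^ 2 - 2 * ρ * γ₁ * γ₂ + γ₂ ^ 2) / (1 - ρ ^ 2)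
      = ((γ₁ - ρ * γ₂) ^ 2 + (d * s) ^ 2) / d ^ 2 := by
    rw [mul_pow, eD, e2]; field_simp; ring
  rw [f1, f2, Real.sqrt_div' _ (sq_nonneg d), Real.sqrt_div' _ (sq_nonneg d), Real.sqrt_sq hrD.le,
    ← eD]
  have hn : 0 < Real.sqrt ((m₁ - ρ * m₂) ^ 2 + (d * m₂) ^ 2) := Real.sqrt_pos.2 (by positivity)
  set n := Real.sqrt ((m₁ - ρ * m₂) ^ 2 + (d * m₂) ^ 2)
  set t := Real.sqrt ((γ₁ - ρ * γ₂) ^ 2 + (d * s) ^ 2)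
  have : t / d * ((m₁ - ρ * m₂) / d ^ 2 / (n / d)) - (γ₁ - ρ * γ₂) / d ^ 2
      = ((m₁ - ρ * m₂) * t - (γ₁ - ρ * γ₂) * n) / (n * d ^ 2) := by field_simp
  rw [this]
  exact div_pos (by linarith) (by positivity)

/-- The bivariate rate function exceeds the common value `1` of the two marginal rates at
`(m₁, m₂)`. After squaring, the difference is
`((m₁² + m₂²) / (2 m₁ m₂) - ρ)² / (1 - ρ²)`. -/
theorem one_lt_joint_rate (hψ : 0 < ψ) (hρ : |ρ| < 1)
    (hm₁ : m₁ = (γ₁ + Real.sqrt (ψ + γ₁ ^ 2)) / ψ)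
    (hm₂ : m₂ = (γ₂ + Real.sqrt (ψ + γ₂ ^ 2)) / ψ) :
    1 < Real.sqrt (ψ + (γ₁ ^ 2 - 2 * ρ * γ₁ * γ₂ + γ₂ ^ 2) / (1 - ρ ^ 2)) *
      Real.sqrt ((m₁ ^ 2 - 2 * ρ * m₁ * m₂ + m₂ ^ 2) / (1 - ρ ^ 2))
      - (m₁ * (γ₁ - ρ * γ₂) + m₂ * (γ₂ - ρ * γ₁)) / (1 - ρ ^ 2) := by
  have hD := one_sub_sq_pos hρ
  have p1 := marginal_scale_pos hψ hm₁
  have p2 := marginal_scale_pos hψ hm₂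
  have q1 : γ₁ = (ψ * m₁ ^ 2 - 1) / (2 * m₁) := by
    rw [eq_div_iff (by positivity)]; linarith [marginal_scale_quadratic hψ hm₁]
  have q2 : γ₂ = (ψ * m₂ ^ 2 - 1) / (2 * m₂) := by
    rw [eq_div_iff (by positivity)]; linarith [marginal_scale_quadratic hψ hm₂]
  have hQ := quad_form_nonneg γ₁ γ₂ hρ
  set B := (m₁ * (γ₁ - ρ * γ₂) + m₂ * (γ₂ - ρ * γ₁)) / (1 - ρ ^ 2) with hB
  rw [← Real.sqrt_mul (by positivity)]
  suffices 1 + B < Real.sqrt ((ψ + (γ₁ ^ 2 - 2 * ρ * γ₁ * γ₂ + γ₂ ^ 2) / (1 - ρ ^ 2)) *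
      ((m₁ ^ 2 - 2 * ρ * m₁ * m₂ + m₂ ^ 2) / (1 - ρ ^ 2))) by linarith
  apply Real.lt_sqrt_of_sq_lt
  have e : (ψ + (γ₁ ^ 2 - 2 * ρ * γ₁ * γ₂ + γ₂ ^ 2) / (1 - ρ ^ 2)) *
      ((m₁ ^ 2 - 2 * ρ * m₁ * m₂ + m₂ ^ 2) / (1 - ρ ^ 2)) - (1 + B) ^ 2
      = ((m₁ ^ 2 + m₂ ^ 2) / (2 * (m₁ * m₂)) - ρ) ^ 2 / (1 - ρ ^ 2) := by
    rw [hB, q1, q2]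
    field_simp
    ring
  have h : 0 < (m₁ ^ 2 + m₂ ^ 2) / (2 * (m₁ * m₂)) - ρ := by
    have : 1 ≤ (m₁ ^ 2 + m₂ ^ 2) / (2 * (m₁ * m₂)) := by
      rw [le_div_iff₀ (by positivity)]
      nlinarith [sq_nonneg (m₁ - m₂)]
    linarith [(abs_lt.1 hρ).2]
  have : 0 < ((m₁ ^ 2 + m₂ ^ 2) / (2 * (m₁ * m₂)) - ρ) ^ 2 / (1 - ρ ^ 2) := by positivity
  linarith

/-- The formula for the residual tail dependence coefficient is the inverse of the bivariate rate
function at `(m₁, m₂)`. -/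
theorem residual_coeff_eq_inv (hψ : 0 < ψ) (hρ : |ρ| < 1) :
    (1 - ρ ^ 2) /
        (Real.sqrt ((ψ * (1 - ρ ^ 2) + γ₁ ^ 2 - 2 * ρ * γ₁ * γ₂ + γ₂ ^ 2) *
            (m₁ ^ 2 - 2 * ρ * m₁ * m₂ + m₂ ^ 2))
          - m₁ * (γ₁ - ρ * γ₂) - m₂ * (γ₂ - ρ * γ₁)) =
    (Real.sqrt (ψ + (γ₁ ^ 2 - 2 * ρ * γ₁ * γ₂ + γ₂ ^ 2) / (1 - ρ ^ 2)) *
      Real.sqrt ((m₁ ^ 2 - 2 * ρ * m₁ * m₂ + m₂ ^ 2) / (1 - ρ ^ 2))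
      - (m₁ * (γ₁ - ρ * γ₂) + m₂ * (γ₂ - ρ * γ₁)) / (1 - ρ ^ 2))⁻¹ := by
  have hD := one_sub_sq_pos hρ
  have hQ := quad_form_nonneg γ₁ γ₂ hρ
  rw [← Real.sqrt_mul (by positivity)]
  have e : (ψ + (γ₁ ^ 2 - 2 * ρ * γ₁ * γ₂ + γ₂ ^ 2) / (1 - ρ ^ 2)) *
      ((m₁ ^ 2 - 2 * ρ * m₁ * m₂ + m₂ ^ 2) / (1 - ρ ^ 2))
      = ((ψ * (1 - ρ ^ 2) + γ₁ ^ 2 - 2 * ρ * γ₁ * γ₂ + γ₂ ^ 2) *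
            (m₁ ^ 2 - 2 * ρ * m₁ * m₂ + m₂ ^ 2)) / (1 - ρ ^ 2) ^ 2 := by
    field_simp
    ring
  rw [e, Real.sqrt_div' _ (sq_nonneg _), Real.sqrt_sq hD.le, ← sub_div, inv_div]
  congr 1
  ring

end Rates

/-! ### Gaussian densities and their products with the mixing density -/

section Densities

/-- The density of the centered normal law with standard deviation `c`. -/
noncomputable def normalDensity (c x : ℝ) : ℝ :=
  (Real.sqrt (2 * Real.pi) * c)⁻¹ * Real.exp (-(x ^ 2 / (2 * c ^ 2)))

theorem normalDensity_nonneg {c : ℝ} (hc : 0 < c) (x : ℝ) : 0 ≤ normalDensity c x := by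
  unfold normalDensity; positivity

theorem lintegral_gaussianReal_affine (m : ℝ) {c : ℝ} (hc : 0 < c) {g : ℝ → ENNReal}
    (hg : Measurable g) :
    ∫⁻ z, g (m + c * z) ∂gaussianReal 0 1
      = ∫⁻ y, ENNReal.ofReal (normalDensity c (y - m)) * g y := by
  have hmap : (gaussianReal 0 1).map (fun z => m + c * z)
      = gaussianReal m (.mk (c ^ 2) (sq_nonneg c)) := by
    have h1 : (fun z : ℝ => m + c * z) = (fun x => m + x) ∘ fun z => c * z := rfl
    rw [h1, ← Measure.map_map (by fun_prop) (by fun_prop), gaussianReal_map_const_mul,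
      gaussianReal_map_const_add]
    congr 1
    · ring
    · simp
  have hv : NNReal.mk (c ^ 2) (sq_nonneg c) ≠ 0 := by
    intro h
    have := congrArg NNReal.toReal h
    simp [hc.ne'] at this
  rw [← lintegral_map (f := g) hg (by fun_prop : Measurable fun z : ℝ => m + c * z), hmap,
    gaussianReal_of_var_ne_zero _ hv, lintegral_withDensity_eq_lintegral_mul _
      (measurable_gaussianPDF _ _) hg]
  refine lintegral_congr fun y => ?_
  simp only [Pi.mul_apply, gaussianPDF, gaussianPDFReal, normalDensity, NNReal.coe_mk]
  congr 3
  · rw [Real.sqrt_mul' _ (sq_nonneg c), Real.sqrt_sq hc.le]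
  · rw [neg_div]

theorem gigMeasure_eq (lam κ ψ : ℝ) :
    gigMeasure lam κ ψ = (volume.restrict (Ioi 0)).withDensity fun r =>
      ENNReal.ofReal (gigKernel lam κ ψ r / ∫ t in Ioi (0 : ℝ), gigKernel lam κ ψ t) := by
  rw [gigMeasure, ← withDensity_indicator measurableSet_Ioi]
  congr 1
  funext r
  by_cases hr : 0 < r
  · simp [gigPDF, hr, indicator]
  · simp [gigPDF, hr, indicator]

theorem lintegral_gigMeasure (lam κ ψ : ℝ) {g : ℝ → ENNReal} (hg : Measurable g) :
    ∫⁻ r, g r ∂gigMeasure lam κ ψ = ∫⁻ r in Ioi (0 : ℝ),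
      ENNReal.ofReal (gigKernel lam κ ψ r / ∫ t in Ioi (0 : ℝ), gigKernel lam κ ψ t) * g r := by
  rw [gigMeasure_eq, lintegral_withDensity_eq_lintegral_mul _ ?_ hg]
  · rfl
  · exact ((measurable_gigKernel lam κ ψ).div_const _).ennreal_ofReal

theorem lintegral_gigKernel_radial (ν : ℝ) {A p C : ℝ} (hA : 0 < A) (hp : 0 < p) (hC : 0 ≤ C) :
    ∫⁻ r in Ioi (0 : ℝ), ENNReal.ofReal (C * gigKernel ν (p ^ 2) A r)
      = ENNReal.ofReal (C * radialFactor ν A p) := by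
  rw [radialFactor, if_neg hp.ne', ← integral_const_mul, ofReal_integral_eq_lintegral_ofReal]
  · exact (integrableOn_gigKernel ν (by positivity) hA).const_mul C
  · exact (ae_restrict_iff' measurableSet_Ioi).2 (Eventually.of_forall fun r hr =>
      mul_nonneg hC (gigKernel_pos hr).le)

theorem gigKernel_mul_normalDensity (lam κ ψ γ a : ℝ) {r : ℝ} (hr : 0 < r) :
    gigKernel lam κ ψ r * normalDensity (Real.sqrt r) (a - r * γ)
      = (Real.sqrt (2 * Real.pi))⁻¹ * Real.exp (γ * a) *
        gigKernel (lam - 1 / 2) (κ + a ^ 2) (ψ + γ ^ 2) r := by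
  have h1 : r ^ (lam - 1 / 2 - 1) = r ^ (lam - 1) * (Real.sqrt r)⁻¹ := by
    rw [Real.sqrt_eq_rpow, ← Real.rpow_neg hr.le, ← Real.rpow_add hr]
    congr 1; ring
  simp only [gigKernel, normalDensity]
  rw [Real.sq_sqrt hr.le, h1, mul_inv]
  have h2 : Real.exp (-(1 / 2) * (κ / r + ψ * r)) * Real.exp (-((a - r * γ) ^ 2 / (2 * r)))
      = Real.exp (γ * a) * Real.exp (-(1 / 2) * ((κ + a ^ 2) / r + (ψ + γ ^ 2) * r)) := by
    rw [← Real.exp_add, ← Real.exp_add]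
    congr 1
    field_simp
    ring
  linear_combination (r ^ (lam - 1) * (Real.sqrt r)⁻¹ * (Real.sqrt (2 * Real.pi))⁻¹) * h2

/-- The joint density of the mixing variable and of the two coordinates: completing the square
produces another unnormalized generalized inverse Gaussian density in `r`. -/
theorem gigKernel_mul_normalDensity_mul (lam κ ψ γ₁ γ₂ a b : ℝ) {ρ r : ℝ} (hρ : |ρ| < 1)
    (hr : 0 < r) :
    gigKernel lam κ ψ r * (normalDensity (Real.sqrt r) (a - r * γ₁) *
        normalDensity (Real.sqrt r * Real.sqrt (1 - ρ ^ 2)) (b - (r * γ₂ + ρ * (a - r * γ₁))))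
      = (2 * Real.pi * Real.sqrt (1 - ρ ^ 2))⁻¹ *
        Real.exp ((γ₁ - ρ * γ₂) / (1 - ρ ^ 2) * a + (γ₂ - ρ * γ₁) / (1 - ρ ^ 2) * b) *
        gigKernel (lam - 1) (κ + (a ^ 2 - 2 * ρ * a * b + b ^ 2) / (1 - ρ ^ 2))
          (ψ + (γ₁ ^ 2 - 2 * ρ * γ₁ * γ₂ + γ₂ ^ 2) / (1 - ρ ^ 2)) r := by
  have hD := one_sub_sq_pos hρ
  have h1 : r ^ (lam - 1 - 1) = r ^ (lam - 1) * r⁻¹ := by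
    rw [Real.rpow_sub_one hr.ne', div_eq_mul_inv]
  have hs : (Real.sqrt r)⁻¹ * (Real.sqrt r)⁻¹ = r⁻¹ := by
    rw [← mul_inv, Real.mul_self_sqrt hr.le]
  have hπ : (Real.sqrt (2 * Real.pi))⁻¹ * (Real.sqrt (2 * Real.pi))⁻¹ = (2 * Real.pi)⁻¹ := by
    rw [← mul_inv, Real.mul_self_sqrt (by positivity)]
  simp only [gigKernel, normalDensity]
  rw [mul_pow, Real.sq_sqrt hr.le, Real.sq_sqrt hD.le, h1]
  have h2 : Real.exp (-(1 / 2) * (κ / r + ψ * r)) * (Real.exp (-((a - r * γ₁) ^ 2 / (2 * r))) *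
      Real.exp (-((b - (r * γ₂ + ρ * (a - r * γ₁))) ^ 2 / (2 * (r * (1 - ρ ^ 2))))))
      = Real.exp ((γ₁ - ρ * γ₂) / (1 - ρ ^ 2) * a + (γ₂ - ρ * γ₁) / (1 - ρ ^ 2) * b) *
        Real.exp (-(1 / 2) * ((κ + (a ^ 2 - 2 * ρ * a * b + b ^ 2) / (1 - ρ ^ 2)) / r +
          (ψ + (γ₁ ^ 2 - 2 * ρ * γ₁ * γ₂ + γ₂ ^ 2) / (1 - ρ ^ 2)) * r)) := by
    rw [← Real.exp_add, ← Real.exp_add, ← Real.exp_add]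
    congr 1
    field_simp
    ring
  simp only [mul_inv] at hπ ⊢
  rw [← hs, ← hπ]
  linear_combination (r ^ (lam - 1) * ((Real.sqrt r)⁻¹ * (Real.sqrt r)⁻¹) *
    ((Real.sqrt (2 * Real.pi))⁻¹ * (Real.sqrt (2 * Real.pi))⁻¹ *
    (Real.sqrt (1 - ρ ^ 2))⁻¹)) * h2

theorem posSemidef_corrMatrix {ρ : ℝ} (hρ : |ρ| < 1) :
    (!![1, ρ; ρ, 1] : Matrix (Fin 2) (Fin 2) ℝ).PosSemidef := by
  refine Matrix.PosSemidef.of_dotProduct_mulVec_nonneg ?_ fun x => ?_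
  · ext i j
    fin_cases i <;> fin_cases j <;> simp
  · have h := quad_form_nonneg (ρ := -ρ) (x 0) (x 1) (by rwa [abs_neg])
    simp only [star_trivial, dotProduct, Matrix.mulVec, Fin.sum_univ_two, Matrix.of_apply,
      Matrix.cons_val_zero, Matrix.cons_val_one, Matrix.cons_val', Matrix.cons_val_fin_one]
    linarith

/-- The bivariate normal law with correlation `ρ` in terms of two independent standard normal
variables. -/
theorem multivariateGaussian_corrMatrix {ρ : ℝ} (hρ : |ρ| < 1) :
    multivariateGaussian 0 !![1, ρ; ρ, 1] = ((gaussianReal 0 1).prod (gaussianReal 0 1)).map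
      fun z => !₂[z.1, ρ * z.1 + Real.sqrt (1 - ρ ^ 2) * z.2] := by
  have hD := one_sub_sq_pos hρ
  have hm : Measurable fun z : ℝ × ℝ =>
      (!₂[z.1, ρ * z.1 + Real.sqrt (1 - ρ ^ 2) * z.2] : EuclideanSpace ℝ (Fin 2)) := by
    fun_prop
  have := Measure.isProbabilityMeasure_map (μ := (gaussianReal 0 1).prod (gaussianReal 0 1))
    hm.aemeasurable
  apply Measure.ext_of_charFun
  ext t
  rw [charFun_multivariateGaussian (posSemidef_corrMatrix hρ), charFun_apply, integral_map
    hm.aemeasurable (by fun_prop)]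
  have e : ∀ z : ℝ × ℝ, Complex.exp ((inner ℝ
      (!₂[z.1, ρ * z.1 + Real.sqrt (1 - ρ ^ 2) * z.2] : EuclideanSpace ℝ (Fin 2)) t : ℝ)
        * Complex.I)
      = Complex.exp (((t 0 + ρ * t 1 : ℝ) : ℂ) * z.1 * Complex.I) *
        Complex.exp (((Real.sqrt (1 - ρ ^ 2) * t 1 : ℝ) : ℂ) * z.2 * Complex.I) := by
    intro z
    rw [← Complex.exp_add]
    congr 1
    simp [PiLp.inner_apply, Fin.sum_univ_two]
    ring
  simp_rw [e]
  rw [integral_prod_mul (fun x : ℝ => Complex.exp (((t 0 + ρ * t 1 : ℝ) : ℂ) * x * Complex.I))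
    (fun x : ℝ => Complex.exp (((Real.sqrt (1 - ρ ^ 2) * t 1 : ℝ) : ℂ) * x * Complex.I)),
    ← charFun_apply_real, ← charFun_apply_real, charFun_gaussianReal, charFun_gaussianReal,
    ← Complex.exp_add]
  congr 1
  have hs : ((Real.sqrt (1 - ρ ^ 2) : ℝ) : ℂ) ^ 2 = 1 - ρ ^ 2 := by
    rw [← Complex.ofReal_pow, Real.sq_sqrt hD.le]; push_cast; ring
  simp [dotProduct, Matrix.mulVec, Fin.sum_univ_two]
  rw [mul_pow, hs]
  ring

end Densities

/-! ### Mixing over the generalized inverse Gaussian law -/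

section Laws

/-- The one-dimensional marginals of a generalized hyperbolic law with unit variances in the
Gaussian factor have density proportional to `ghDensity₁`. -/
theorem lintegral_ghMeasure_coord {d : ℕ} {lam κ ψ : ℝ} {γ μ : EuclideanSpace ℝ (Fin d)}
    {S : Matrix (Fin d) (Fin d) ℝ} (hκ : 0 ≤ κ) (hψ : 0 < ψ) (hS : S.PosSemidef) {i : Fin d}
    (hSi : S i i = 1) {g : ℝ → ENNReal} (hg : Measurable g) :
    ∫⁻ v, g (v i) ∂ghMeasure lam κ ψ γ μ S = ∫⁻ y, ENNReal.ofReal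
      ((∫ t in Ioi (0 : ℝ), gigKernel lam κ ψ t)⁻¹ * (Real.sqrt (2 * Real.pi))⁻¹ *
        Real.exp (-(γ i * μ i)) * ghDensity₁ lam κ ψ (γ i) (μ i) y) * g y := by
  set I := ∫ t in Ioi (0 : ℝ), gigKernel lam κ ψ t with hI
  have hI0 : 0 ≤ I := setIntegral_nonneg measurableSet_Ioi fun t ht => (gigKernel_pos ht).le
  have hgi : Measurable fun v : EuclideanSpace ℝ (Fin d) => g (v i) := hg.comp (by fun_prop)
  have hmp := measurePreserving_eval_multivariateGaussian (μ := 0) hS (i := i)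
  rw [hSi] at hmp
  simp only [PiLp.zero_apply, Real.toNNReal_one] at hmp
  rw [ghMeasure, lintegral_map hgi (by fun_prop)]
  simp only [PiLp.add_apply, PiLp.smul_apply, smul_eq_mul]
  have hgm : Measurable fun p : ℝ × ℝ => g (μ i + p.1 * γ i + Real.sqrt p.1 * p.2) :=
    hg.comp (by fun_prop)
  have hgm' : Measurable fun p : ℝ × EuclideanSpace ℝ (Fin d) =>
      g (μ i + p.1 * γ i + Real.sqrt p.1 * p.2 i) := hg.comp (by fun_prop)
  rw [lintegral_prod _ hgm'.aemeasurable]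
  have h1 : ∀ r : ℝ, ∫⁻ w, g (μ i + r * γ i + Real.sqrt r * w i) ∂multivariateGaussian 0 S
      = ∫⁻ z, g (μ i + r * γ i + Real.sqrt r * z) ∂gaussianReal 0 1 := fun r =>
    hmp.lintegral_comp (f := fun z => g (μ i + r * γ i + Real.sqrt r * z)) (hg.comp (by fun_prop))
  simp_rw [h1]
  rw [lintegral_gigMeasure _ _ _ hgm.lintegral_prod_right']
  -- Conditionally on `R = r` the coordinate is normal with mean `μ + r γ` and variance `r`.
  have h2 : ∀ r ∈ Ioi (0 : ℝ), ENNReal.ofReal (gigKernel lam κ ψ r / I) *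
      ∫⁻ z, g (μ i + r * γ i + Real.sqrt r * z) ∂gaussianReal 0 1
      = ∫⁻ y, ENNReal.ofReal (I⁻¹ * (Real.sqrt (2 * Real.pi))⁻¹ *
        Real.exp (γ i * (y - μ i)) * gigKernel (lam - 1 / 2) (κ + (y - μ i) ^ 2) (ψ + γ i ^ 2) r) *
          g y := by
    intro r hr
    have hr : 0 < r := hr
    have hn := normalDensity_nonneg (Real.sqrt_pos.2 hr)
    rw [lintegral_gaussianReal_affine _ (Real.sqrt_pos.2 hr) hg, ← lintegral_const_mul' _ _
      ENNReal.ofReal_ne_top]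
    refine lintegral_congr fun y => ?_
    rw [← mul_assoc, ← ENNReal.ofReal_mul (div_nonneg (gigKernel_pos hr).le hI0)]
    congr 2
    rw [show y - (μ i + r * γ i) = (y - μ i) - r * γ i by ring]
    have := gigKernel_mul_normalDensity lam κ ψ (γ i) (y - μ i) hr
    rw [div_mul_eq_mul_div, this]
    ring
  rw [setLIntegral_congr_fun measurableSet_Ioi h2, lintegral_lintegral_swap]
  · refine lintegral_congr_ae ?_
    filter_upwards [Measure.ae_ne volume (μ i)] with y hy
    have hp : 0 < κ + (y - μ i) ^ 2 := by
      have : 0 < (y - μ i) ^ 2 := by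
        have := sub_ne_zero.2 hy
        positivity
      linarith
    rw [lintegral_mul_const]
    · have h3 := lintegral_gigKernel_radial (lam - 1 / 2) (A := ψ + γ i ^ 2)
        (p := Real.sqrt (κ + (y - μ i) ^ 2))
        (C := I⁻¹ * (Real.sqrt (2 * Real.pi))⁻¹ * Real.exp (γ i * (y - μ i)))
        (by positivity) (Real.sqrt_pos.2 hp) (by positivity)
      rw [Real.sq_sqrt hp.le] at h3
      rw [h3, ghDensity₁, show γ i * (y - μ i) = -(γ i * μ i) + γ i * y by ring, Real.exp_add]
      congr 2
      ring
    · exact ((measurable_gigKernel _ _ _).const_mul _).ennreal_ofReal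
  · refine Measurable.aemeasurable ?_
    refine Measurable.mul ?_ (hg.comp measurable_snd)
    refine Measurable.ennreal_ofReal ?_
    unfold gigKernel
    fun_prop

/-- The linear map with `‖whitening ρ y‖² = (y₁² - 2 ρ y₁ y₂ + y₂²) / (1 - ρ²)`. The first
coordinate is left free, to accommodate the parameter `κ`. -/
noncomputable def whitening (ρ : ℝ) : ℝ × ℝ →L[ℝ] EuclideanSpace ℝ (Fin 3) :=
  LinearMap.toContinuousLinearMap
    { toFun := fun y => !₂[0, y.1, (y.2 - ρ * y.1) / Real.sqrt (1 - ρ ^ 2)]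
      map_add' := fun x y => by
        ext i
        fin_cases i <;> simp; ring
      map_smul' := fun c x => by
        ext i
        fin_cases i <;> simp; ring }

theorem whitening_apply (ρ : ℝ) (y : ℝ × ℝ) :
    whitening ρ y = !₂[0, y.1, (y.2 - ρ * y.1) / Real.sqrt (1 - ρ ^ 2)] := rfl

/-- The offset for which `‖whiteningOffset κ μ₁ μ₂ ρ + whitening ρ y‖²` is `κ` plus the quadratic
form of `y - (μ₁, μ₂)`. -/
noncomputable def whiteningOffset (κ μ₁ μ₂ ρ : ℝ) : EuclideanSpace ℝ (Fin 3) :=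
  !₂[Real.sqrt κ, -μ₁, -(μ₂ - ρ * μ₁) / Real.sqrt (1 - ρ ^ 2)]

/-- The linear form `y ↦ ⟪γ, y⟫` in the inner product defined by `!![1, ρ; ρ, 1]⁻¹`. -/
noncomputable def tilt (γ₁ γ₂ ρ : ℝ) : ℝ × ℝ →L[ℝ] ℝ :=
  ((γ₁ - ρ * γ₂) / (1 - ρ ^ 2)) • ContinuousLinearMap.fst ℝ ℝ ℝ +
    ((γ₂ - ρ * γ₁) / (1 - ρ ^ 2)) • ContinuousLinearMap.snd ℝ ℝ ℝ

theorem tilt_apply (γ₁ γ₂ ρ : ℝ) (y : ℝ × ℝ) : tilt γ₁ γ₂ ρ y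
    = (γ₁ - ρ * γ₂) / (1 - ρ ^ 2) * y.1 + (γ₂ - ρ * γ₁) / (1 - ρ ^ 2) * y.2 := by
  simp [tilt]

theorem norm_sq_whitening_add {κ μ₁ μ₂ ρ : ℝ} (hκ : 0 ≤ κ) (hρ : |ρ| < 1) (y : ℝ × ℝ) :
    ‖whiteningOffset κ μ₁ μ₂ ρ + whitening ρ y‖ ^ 2 = κ +
      ((y.1 - μ₁) ^ 2 - 2 * ρ * (y.1 - μ₁) * (y.2 - μ₂) + (y.2 - μ₂) ^ 2) / (1 - ρ ^ 2) := by
  have hD := one_sub_sq_pos hρ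
  have e : -(μ₂ - ρ * μ₁) / Real.sqrt (1 - ρ ^ 2) + (y.2 - ρ * y.1) / Real.sqrt (1 - ρ ^ 2)
      = ((y.2 - μ₂) - ρ * (y.1 - μ₁)) / Real.sqrt (1 - ρ ^ 2) := by ring
  rw [whitening_apply, whiteningOffset, EuclideanSpace.real_norm_sq_eq]
  simp only [Fin.sum_univ_three, PiLp.add_apply, Matrix.cons_val_zero,
    Matrix.cons_val_one, Matrix.cons_val]
  rw [e, div_pow, Real.sq_sqrt hD.le, add_zero, Real.sq_sqrt hκ]
  field_simp
  ring

theorem inner_whitening {ρ : ℝ} (hρ : |ρ| < 1) (x y : ℝ × ℝ) :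
    inner ℝ (whitening ρ x) (whitening ρ y)
      = (x.1 * y.1 - ρ * (x.1 * y.2 + x.2 * y.1) + x.2 * y.2) / (1 - ρ ^ 2) := by
  have hD := one_sub_sq_pos hρ
  have hd := Real.sqrt_pos.2 hD
  have e := Real.sq_sqrt hD.le
  rw [whitening_apply, whitening_apply, PiLp.inner_apply]
  simp only [Fin.sum_univ_three, Matrix.cons_val_zero,
    Matrix.cons_val_one, Matrix.cons_val, RCLike.inner_apply, conj_trivial]
  have e2 : (y.2 - ρ * y.1) / Real.sqrt (1 - ρ ^ 2) * ((x.2 - ρ * x.1) / Real.sqrt (1 - ρ ^ 2))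
      = (y.2 - ρ * y.1) * (x.2 - ρ * x.1) / (1 - ρ ^ 2) := by
    rw [div_mul_div_comm, Real.mul_self_sqrt hD.le]
  rw [e2]
  field_simp
  ring

theorem norm_whitening {ρ : ℝ} (hρ : |ρ| < 1) (y : ℝ × ℝ) :
    ‖whitening ρ y‖ = Real.sqrt ((y.1 ^ 2 - 2 * ρ * y.1 * y.2 + y.2 ^ 2) / (1 - ρ ^ 2)) := by
  rw [norm_eq_sqrt_real_inner, inner_whitening hρ]
  congr 2
  ring

theorem sub_le_norm_whitening_add (κ μ₁ μ₂ ρ : ℝ) (y : ℝ × ℝ) :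
    y.1 - μ₁ ≤ ‖whiteningOffset κ μ₁ μ₂ ρ + whitening ρ y‖ := by
  have h := PiLp.norm_apply_le (whiteningOffset κ μ₁ μ₂ ρ + whitening ρ y) 1
  refine le_trans ?_ h
  rw [Real.norm_eq_abs]
  refine le_trans (le_of_eq ?_) (le_abs_self _)
  rw [whitening_apply, whiteningOffset]
  simp only [PiLp.add_apply, Matrix.cons_val_one, Matrix.cons_val_zero]
  ring

/-- The density of the bivariate generalized hyperbolic law with correlation matrix
`!![1, ρ; ρ, 1]`, up to a constant factor. -/
noncomputable def ghDensity₂ (lam κ ψ γ₁ γ₂ μ₁ μ₂ ρ : ℝ) : ℝ × ℝ → ℝ :=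
  tiltedDensity (radialFactor (lam - 1)
    (ψ + (γ₁ ^ 2 - 2 * ρ * γ₁ * γ₂ + γ₂ ^ 2) / (1 - ρ ^ 2)))
    (whiteningOffset κ μ₁ μ₂ ρ) (whitening ρ) (tilt γ₁ γ₂ ρ)

/-- The bivariate law with correlation matrix `!![1, ρ; ρ, 1]` has density proportional to
`ghDensity₂`. -/
theorem lintegral_ghMeasure_pair {lam κ ψ γ₁ γ₂ μ₁ μ₂ ρ : ℝ} (hκ : 0 ≤ κ) (hψ : 0 < ψ)
    (hρ : |ρ| < 1) {g : ℝ × ℝ → ENNReal} (hg : Measurable g) :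
    ∫⁻ v, g (v 0, v 1) ∂ghMeasure lam κ ψ !₂[γ₁, γ₂] !₂[μ₁, μ₂] !![1, ρ; ρ, 1] =
      ∫⁻ y, ENNReal.ofReal ((∫ t in Ioi (0 : ℝ), gigKernel lam κ ψ t)⁻¹ *
        (2 * Real.pi * Real.sqrt (1 - ρ ^ 2))⁻¹ * Real.exp (-tilt γ₁ γ₂ ρ (μ₁, μ₂)) *
        ghDensity₂ lam κ ψ γ₁ γ₂ μ₁ μ₂ ρ y) * g y := by
  set I := ∫ t in Ioi (0 : ℝ), gigKernel lam κ ψ t with hI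
  have hI0 : 0 ≤ I := setIntegral_nonneg measurableSet_Ioi fun t ht => (gigKernel_pos ht).le
  have hD := one_sub_sq_pos hρ
  have hd := Real.sqrt_pos.2 hD
  set d := Real.sqrt (1 - ρ ^ 2) with hdd
  set Q : ℝ × ℝ → ℝ := fun y => ((y.1 - μ₁) ^ 2 - 2 * ρ * (y.1 - μ₁) * (y.2 - μ₂) +
    (y.2 - μ₂) ^ 2) / (1 - ρ ^ 2) with hQ
  set A := ψ + (γ₁ ^ 2 - 2 * ρ * γ₁ * γ₂ + γ₂ ^ 2) / (1 - ρ ^ 2) with hA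
  have hA0 : 0 < A := by
    have := div_nonneg (quad_form_nonneg γ₁ γ₂ hρ) hD.le
    linarith
  have hg2 : Measurable fun v : EuclideanSpace ℝ (Fin 2) => g (v 0, v 1) :=
    hg.comp (by fun_prop)
  have hgm : Measurable fun p : ℝ × (ℝ × ℝ) => g (μ₁ + p.1 * γ₁ + Real.sqrt p.1 * p.2.1,
      μ₂ + p.1 * γ₂ + Real.sqrt p.1 * (ρ * p.2.1 + d * p.2.2)) := hg.comp (by fun_prop)
  have hgm' : Measurable fun p : ℝ × EuclideanSpace ℝ (Fin 2) =>
      g (μ₁ + p.1 * γ₁ + Real.sqrt p.1 * p.2 0, μ₂ + p.1 * γ₂ + Real.sqrt p.1 * p.2 1) :=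
    hg.comp (by fun_prop)
  rw [ghMeasure, lintegral_map hg2 (by fun_prop)]
  simp only [PiLp.add_apply, PiLp.smul_apply, smul_eq_mul, Matrix.cons_val_zero,
    Matrix.cons_val_one]
  rw [lintegral_prod _ hgm'.aemeasurable]
  have h1 : ∀ r : ℝ, ∫⁻ w, g (μ₁ + r * γ₁ + Real.sqrt r * w 0, μ₂ + r * γ₂ + Real.sqrt r * w 1)
        ∂multivariateGaussian 0 !![1, ρ; ρ, 1]
      = ∫⁻ z, g (μ₁ + r * γ₁ + Real.sqrt r * z.1,
        μ₂ + r * γ₂ + Real.sqrt r * (ρ * z.1 + d * z.2))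
          ∂(gaussianReal 0 1).prod (gaussianReal 0 1) := by
    intro r
    have hgr : Measurable fun w : EuclideanSpace ℝ (Fin 2) =>
        g (μ₁ + r * γ₁ + Real.sqrt r * w 0, μ₂ + r * γ₂ + Real.sqrt r * w 1) :=
      hg.comp (by fun_prop)
    rw [multivariateGaussian_corrMatrix hρ, lintegral_map hgr (by fun_prop)]
    rfl
  simp_rw [h1]
  rw [lintegral_gigMeasure _ _ _ hgm.lintegral_prod_right']
  -- Conditionally on `R = r`, the first coordinate is normal with variance `r`, and the second one
  -- given the first is normal with variance `r (1 - ρ²)`.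
  have h2 : ∀ r ∈ Ioi (0 : ℝ), ENNReal.ofReal (gigKernel lam κ ψ r / I) *
      ∫⁻ z, g (μ₁ + r * γ₁ + Real.sqrt r * z.1, μ₂ + r * γ₂ + Real.sqrt r * (ρ * z.1 + d * z.2))
          ∂(gaussianReal 0 1).prod (gaussianReal 0 1)
      = ∫⁻ y : ℝ × ℝ, ENNReal.ofReal (I⁻¹ * (2 * Real.pi * d)⁻¹ *
        Real.exp (tilt γ₁ γ₂ ρ (y.1 - μ₁, y.2 - μ₂)) * gigKernel (lam - 1) (κ + Q y) A r) *
          g y := by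
    intro r hr
    have hr : 0 < r := hr
    have hsr := Real.sqrt_pos.2 hr
    have hgr : Measurable fun z : ℝ × ℝ => g (μ₁ + r * γ₁ + Real.sqrt r * z.1,
        μ₂ + r * γ₂ + Real.sqrt r * (ρ * z.1 + d * z.2)) := hg.comp (by fun_prop)
    have hnm : ∀ c : ℝ, Measurable (normalDensity c) := fun c => by
      unfold normalDensity; fun_prop
    rw [lintegral_prod _ hgr.aemeasurable]
    have hinner : ∀ z₁ : ℝ, ∫⁻ z₂, g (μ₁ + r * γ₁ + Real.sqrt r * z₁,
          μ₂ + r * γ₂ + Real.sqrt r * (ρ * z₁ + d * z₂)) ∂gaussianReal 0 1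
        = (fun y₁ => ∫⁻ y₂, ENNReal.ofReal (normalDensity (Real.sqrt r * d)
          (y₂ - (μ₂ + r * γ₂ + ρ * (y₁ - (μ₁ + r * γ₁))))) * g (y₁, y₂))
            (μ₁ + r * γ₁ + Real.sqrt r * z₁) := by
      intro z₁
      simp only
      rw [← lintegral_gaussianReal_affine (g := fun y₂ => g (μ₁ + r * γ₁ + Real.sqrt r * z₁, y₂))
        (μ₂ + r * γ₂ + ρ * (μ₁ + r * γ₁ + Real.sqrt r * z₁ - (μ₁ + r * γ₁))) (mul_pos hsr hd)
        (hg.comp (by fun_prop))]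
      refine lintegral_congr fun z₂ => ?_
      congr 2
      ring
    simp only [hinner]
    have hm2 : Measurable fun y : ℝ × ℝ => ENNReal.ofReal (normalDensity (Real.sqrt r * d)
          (y.2 - (μ₂ + r * γ₂ + ρ * (y.1 - (μ₁ + r * γ₁))))) * g y :=
      ((hnm _).comp (by fun_prop)).ennreal_ofReal.mul hg
    rw [lintegral_gaussianReal_affine _ hsr hm2.lintegral_prod_right']
    simp_rw [← lintegral_const_mul' _ _ ENNReal.ofReal_ne_top]
    rw [Measure.volume_eq_prod, lintegral_prod]
    · refine lintegral_congr fun y₁ => lintegral_congr fun y₂ => ?_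
      rw [← mul_assoc, ← mul_assoc, ← ENNReal.ofReal_mul (div_nonneg (gigKernel_pos hr).le hI0),
        ← ENNReal.ofReal_mul (mul_nonneg (div_nonneg (gigKernel_pos hr).le hI0)
          (normalDensity_nonneg hsr _))]
      congr 2
      have := gigKernel_mul_normalDensity_mul lam κ ψ γ₁ γ₂ (y₁ - μ₁) (y₂ - μ₂) hρ hr
      rw [show y₁ - (μ₁ + r * γ₁) = (y₁ - μ₁) - r * γ₁ by ring,
        show y₂ - (μ₂ + r * γ₂ + ρ * (y₁ - μ₁ - r * γ₁))
          = (y₂ - μ₂) - (r * γ₂ + ρ * (y₁ - μ₁ - r * γ₁)) by ring,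
        tilt_apply, mul_assoc, div_mul_eq_mul_div, this]
      ring
    · refine Measurable.aemeasurable (Measurable.mul (Measurable.ennreal_ofReal ?_) hg)
      have := (tilt γ₁ γ₂ ρ).continuous.measurable
      unfold gigKernel
      fun_prop
  rw [setLIntegral_congr_fun measurableSet_Ioi h2, lintegral_lintegral_swap]
  · refine lintegral_congr_ae ?_
    filter_upwards [Measure.ae_ne volume (μ₁, μ₂)] with y hy
    have hp : 0 < κ + Q y := by
      have : 0 < Q y := by
        refine div_pos ?_ hD
        rcases eq_or_ne y.1 μ₁ with h | h
        · have h' : y.2 - μ₂ ≠ 0 := fun h' => hy (Prod.ext h (sub_eq_zero.1 h'))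
          rw [h, sub_self]
          have : 0 < (y.2 - μ₂) ^ 2 := by positivity
          simpa using this
        · have h' := sub_ne_zero.2 h
          have h3 : 0 < (1 - ρ ^ 2) * (y.1 - μ₁) ^ 2 := by positivity
          nlinarith [sq_nonneg ((y.2 - μ₂) - ρ * (y.1 - μ₁))]
      linarith
    rw [lintegral_mul_const]
    · have hnorm : ‖whiteningOffset κ μ₁ μ₂ ρ + whitening ρ y‖ = Real.sqrt (κ + Q y) := by
        rw [← norm_sq_whitening_add hκ hρ y, Real.sqrt_sq (norm_nonneg _)]
      have h3 := lintegral_gigKernel_radial (lam - 1) (A := A) (p := Real.sqrt (κ + Q y))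
        (C := I⁻¹ * (2 * Real.pi * d)⁻¹ * Real.exp (tilt γ₁ γ₂ ρ (y.1 - μ₁, y.2 - μ₂)))
        hA0 (Real.sqrt_pos.2 hp) (by positivity)
      rw [Real.sq_sqrt hp.le] at h3
      rw [h3, ghDensity₂, tiltedDensity, hnorm,
        show (y.1 - μ₁, y.2 - μ₂) = -(μ₁, μ₂) + y by ext <;> simp <;> ring, map_add, map_neg,
        Real.exp_add]
      congr 2
      ring
    · exact ((measurable_gigKernel _ _ _).const_mul _).ennreal_ofReal
  · refine Measurable.aemeasurable ?_
    refine Measurable.mul (Measurable.ennreal_ofReal ?_) (hg.comp measurable_snd)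
    have := (tilt γ₁ γ₂ ρ).continuous.measurable
    unfold gigKernel
    fun_prop

end Laws

/-! ### Quantiles of a law with a positive density of exponential decay -/

section Quantile

theorem one_sub_inv_mem_Ioo {s : ℝ} (hs : 1 < s) : 1 - s⁻¹ ∈ Ioo (0 : ℝ) 1 := by
  have h1 : s⁻¹ < 1 := inv_lt_one_of_one_lt₀ hs
  have h2 : 0 < s⁻¹ := inv_pos.2 (by linarith)
  constructor <;> linarith

theorem measureReal_pos_of_eq_withDensity {α : Type*} [MeasureSpace α] {ν : Measure α}
    [IsFiniteMeasure ν] {f : α → ℝ} (hf : Measurable f) (hpos : ∀ x, 0 < f x)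
    (hν : ν = volume.withDensity fun x => ENNReal.ofReal (f x)) {S : Set α} (hS : volume S ≠ 0) :
    0 < ν.real S := by
  have hac : volume ≪ ν := by
    rw [hν]
    exact withDensity_absolutelyContinuous' hf.ennreal_ofReal.aemeasurable
      (ae_of_all _ fun z => by simpa using hpos z)
  exact ENNReal.toReal_pos (fun h => hS (hac h)) (measure_ne_top _ _)

theorem measureReal_eq_integral_of_eq_withDensity {α : Type*} [MeasureSpace α] {ν : Measure α}
    {f : α → ℝ} (hf : Measurable f) (hpos : ∀ x, 0 < f x)
    (hν : ν = volume.withDensity fun x => ENNReal.ofReal (f x)) {S : Set α}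
    (hS : MeasurableSet S) : ν.real S = ∫ x in S, f x := by
  rw [measureReal_def, hν, withDensity_apply _ hS,
    integral_eq_lintegral_of_nonneg_ae (ae_of_all _ fun x => (hpos x).le)
      hf.aestronglyMeasurable]

theorem strictMono_cdf_of_eq_withDensity {ν : Measure ℝ} [IsProbabilityMeasure ν] {f : ℝ → ℝ}
    (hf : Measurable f) (hpos : ∀ x, 0 < f x)
    (hν : ν = volume.withDensity fun x => ENNReal.ofReal (f x)) : StrictMono (cdf ν) := by
  intro x y hxy
  rw [cdf_eq_real, cdf_eq_real, ← Iic_union_Ioc_eq_Iic hxy.le,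
    measureReal_union (Iic_disjoint_Ioc le_rfl) measurableSet_Ioc]
  have := measureReal_pos_of_eq_withDensity hf hpos hν (S := Ioc x y) (by simp [hxy.not_ge])
  linarith

theorem continuous_cdf_of_ac {ν : Measure ℝ} [IsProbabilityMeasure ν] (hν : ν ≪ volume) :
    Continuous (cdf ν) := by
  rw [continuous_iff_continuousAt]
  intro x
  have h1 : (cdf ν).measure {x} = 0 := by
    rw [measure_cdf]; exact hν (by simp)
  rw [StieltjesFunction.measure_singleton, ENNReal.ofReal_eq_zero] at h1
  have h2 := (cdf ν).mono.leftLim_le (le_refl x)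
  rw [(cdf ν).mono.continuousAt_iff_leftLim_eq_rightLim, StieltjesFunction.rightLim_eq]
  linarith

theorem exists_quantile {ν : Measure ℝ} [IsProbabilityMeasure ν] (hc : Continuous (cdf ν))
    (hs : StrictMono (cdf ν)) :
    ∃ q : ℝ → ℝ, (∀ u ∈ Ioo (0 : ℝ) 1, cdf ν (q u) = u) ∧ Tendsto q (𝓝[<] 1) atTop := by
  have h : ∀ u ∈ Ioo (0 : ℝ) 1, ∃ x, cdf ν x = u := by
    intro u hu
    refine mem_range_of_exists_le_of_exists_ge hc ?_ ?_
    · exact ((tendsto_cdf_atBot ν).eventually_le_const hu.1).exists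
    · exact ((tendsto_cdf_atTop ν).eventually_const_le hu.2).exists
  choose! q hq using h
  refine ⟨q, hq, tendsto_atTop.2 fun K => ?_⟩
  have hK : cdf ν K < 1 := (hs (lt_add_one K)).trans_le (cdf_le_one ν _)
  filter_upwards [Ioo_mem_nhdsLT (max_lt hK one_pos)] with u hu
  have hu0 := (le_max_right _ _).trans_lt hu.1
  by_contra! hlt
  have := hs hlt
  rw [hq u ⟨hu0, hu.2⟩] at this
  exact absurd ((le_max_left _ _).trans_lt hu.1) (not_lt.2 this.le)

variable {θ : ℝ} {T Q : ℝ → ℝ}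

theorem tendsto_inv_log_mul_quantile (hT : HasExpRate θ T) (hT0 : ∀ x, 0 < T x) (hθ : 0 < θ)
    (hQ : Tendsto Q atTop atTop) (hTQ : ∀ᶠ s in atTop, T (Q s) = s⁻¹) :
    Tendsto (fun s => (Real.log s)⁻¹ * Q s) atTop (𝓝 θ⁻¹) := by
  have h := ((hT.tendsto_log_div hT0).comp hQ).neg.inv₀ (by simpa using hθ.ne')
  rw [neg_neg] at h
  refine h.congr' ?_
  filter_upwards [hTQ] with s hs
  simp only [Function.comp_apply]
  rw [hs, Real.log_inv, neg_div, neg_neg, inv_div, inv_mul_eq_div]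

/-- Multiplying `s` by `t` divides the tail `T (Q s) = s⁻¹` by `t`, which shifts the quantile `Q s`
by `log t / θ` in the limit. -/
theorem tendsto_quantile_sub (hT : HasExpRate θ T) (hT0 : ∀ x, 0 < T x) (hTa : Antitone T)
    (hθ : 0 < θ) (hQ : Tendsto Q atTop atTop) (hTQ : ∀ᶠ s in atTop, T (Q s) = s⁻¹) {t : ℝ}
    (ht : 0 < t) :
    Tendsto (fun s => Q (t * s) - Q s) atTop (𝓝 (Real.log t * θ⁻¹)) := by
  have hts : ∀ᶠ s in atTop, T (Q (t * s)) = t⁻¹ * T (Q s) := by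
    filter_upwards [hTQ, (tendsto_id.const_mul_atTop ht).eventually hTQ] with s h1 h2
    rw [h1, ← mul_inv]
    exact h2
  have hlim : ∀ c, Tendsto (fun s => T (Q s + c) / T (Q s)) atTop (𝓝 (Real.exp (-θ * c))) :=
    fun c => hT.tendsto_div hT0 hQ (by simp)
  have hexp : ∀ ε, Real.exp (-θ * (Real.log t * θ⁻¹ + ε)) = t⁻¹ * Real.exp (-θ * ε) := by
    intro ε
    rw [mul_add, Real.exp_add]
    congr 1
    rw [show -θ * (Real.log t * θ⁻¹) = -Real.log t by field_simp, Real.exp_neg, Real.exp_log ht]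
  rw [Metric.tendsto_nhds]
  intro ε hε
  have hti : 0 < t⁻¹ := inv_pos.2 ht
  have h1 : ∀ᶠ s in atTop, T (Q s + (Real.log t * θ⁻¹ + ε)) / T (Q s) < t⁻¹ := by
    refine (hlim _).eventually_lt_const ?_
    rw [hexp]
    exact mul_lt_of_lt_one_right hti (Real.exp_lt_one_iff.2 (by nlinarith))
  have h2 : ∀ᶠ s in atTop, t⁻¹ < T (Q s + (Real.log t * θ⁻¹ + -ε)) / T (Q s) := by
    refine (hlim _).eventually_const_lt ?_
    rw [hexp]
    exact lt_mul_of_one_lt_right hti (Real.one_lt_exp_iff.2 (by nlinarith))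
  filter_upwards [hts, h1, h2] with s h0 h1 h2
  rw [div_lt_iff₀ (hT0 _), ← h0] at h1
  rw [lt_div_iff₀ (hT0 _), ← h0] at h2
  have a1 := hTa.reflect_lt h1
  have a2 := hTa.reflect_lt h2
  rw [Real.dist_eq, abs_lt]
  constructor <;> linarith

/-- The quantile function of a law with a positive density of exponential decay. -/
theorem exists_quantile_of_hasExpRate {ν : Measure ℝ} [IsProbabilityMeasure ν] {f : ℝ → ℝ}
    (hf : Measurable f) (hpos : ∀ x, 0 < f x)
    (hν : ν = volume.withDensity fun x => ENNReal.ofReal (f x)) (hθ : 0 < θ)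
    (hrate : HasExpRate θ f) :
    ∃ q : ℝ → ℝ, (∀ u ∈ Ioo (0 : ℝ) 1, ∀ x, u < cdf ν x ↔ q u < x) ∧
      (∀ u ∈ Ioo (0 : ℝ) 1, ν.real (Ioi (q u)) = 1 - u) ∧
      Tendsto (fun s => (Real.log s)⁻¹ * q (1 - s⁻¹)) atTop (𝓝 θ⁻¹) ∧
      ∀ t, 0 < t → Tendsto (fun s => q (1 - (t * s)⁻¹) - q (1 - s⁻¹)) atTop
        (𝓝 (Real.log t * θ⁻¹)) := by
  have hmono := strictMono_cdf_of_eq_withDensity hf hpos hν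
  obtain ⟨q, hq, hqtop⟩ := exists_quantile
    (continuous_cdf_of_ac (by rw [hν]; exact withDensity_absolutelyContinuous _ _)) hmono
  have hint : Integrable f := by
    refine (lintegral_ofReal_ne_top_iff_integrable hf.aestronglyMeasurable
      (ae_of_all _ fun x => (hpos x).le)).1 ?_
    have h := measure_ne_top ν univ
    rwa [hν, withDensity_apply _ MeasurableSet.univ, Measure.restrict_univ] at h
  have htail : ∀ x, ν.real (Ioi x) = 1 - cdf ν x := fun x => by
    rw [← compl_Iic, probReal_compl_eq_one_sub measurableSet_Iic, cdf_eq_real]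
  have hTq : ∀ u ∈ Ioo (0 : ℝ) 1, ν.real (Ioi (q u)) = 1 - u := fun u hu => by
    rw [htail, hq u hu]
  have hTrate : HasExpRate θ fun x => ν.real (Ioi x) := by
    have h := hrate.tail hint
    refine h.congr (Eventually.of_forall fun x => ?_)
    simp only
    rw [measureReal_eq_integral_of_eq_withDensity hf hpos hν measurableSet_Ioi]
    have h := (measurePreserving_add_right volume x).setIntegral_preimage_emb
      (measurableEmbedding_addRight x) f (Ioi x)
    simpa using h
  have hT0 : ∀ x, 0 < ν.real (Ioi x) := fun x =>
    measureReal_pos_of_eq_withDensity hf hpos hν (by simp)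
  have hTa : Antitone fun x => ν.real (Ioi x) := fun x y hxy =>
    measureReal_mono (Ioi_subset_Ioi hxy)
  have hlim : Tendsto (fun s : ℝ => 1 - s⁻¹) atTop (𝓝[<] 1) := by
    refine tendsto_nhdsWithin_iff.2 ⟨?_, ?_⟩
    · simpa using tendsto_inv_atTop_zero.const_sub (1 : ℝ)
    · filter_upwards [eventually_gt_atTop 0] with s hs
      simpa using hs
  have hTQ : ∀ᶠ s : ℝ in atTop, ν.real (Ioi (q (1 - s⁻¹))) = s⁻¹ := by
    filter_upwards [eventually_gt_atTop 1] with s hs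
    rw [hTq _ (one_sub_inv_mem_Ioo hs), sub_sub_cancel]
  refine ⟨q, fun u hu x => ?_, hTq, ?_, fun t ht => ?_⟩
  · have := hmono.lt_iff_lt (a := q u) (b := x)
    rwa [hq u hu] at this
  · exact tendsto_inv_log_mul_quantile hTrate hT0 hθ (hqtop.comp hlim) hTQ
  · exact tendsto_quantile_sub hTrate hT0 hTa hθ (hqtop.comp hlim) hTQ ht

end Quantile

/-! ### Regular variation of the joint tail -/

section RegularVariation

/-- A function bounded by `1` for which doubling the argument contracts by a factor `c < 1` in the
limit tends to `0`. -/
theorem tendsto_zero_of_doubling {V : ℝ → ℝ} {c : ℝ} (hc : c < 1) (hpos : ∀ᶠ s in atTop, 0 < V s)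
    (hle : ∀ᶠ s in atTop, V s ≤ 1) (h : Tendsto (fun s => V (2 * s) / V s) atTop (𝓝 c)) :
    Tendsto V atTop (𝓝 0) := by
  obtain ⟨c', hc1, hc2⟩ := exists_between (max_lt hc one_pos)
  have hc0 : 0 < c' := (le_max_right _ _).trans_lt hc1
  have hdbl : ∀ᶠ s in atTop, V (2 * s) ≤ c' * V s := by
    filter_upwards [h.eventually_lt_const ((le_max_left _ _).trans_lt hc1), hpos] with s h1 h2
    exact ((div_lt_iff₀ h2).1 h1).le
  have hpow : ∀ n : ℕ, ∀ᶠ s in atTop, V s ≤ c' ^ n := by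
    intro n
    induction n with
    | zero => simpa using hle
    | succ n ih =>
      have hhalf : Tendsto (fun s : ℝ => 2⁻¹ * s) atTop atTop :=
        tendsto_id.const_mul_atTop (by norm_num)
      filter_upwards [hhalf.eventually hdbl, hhalf.eventually ih] with s h1 h2
      rw [mul_inv_cancel_left₀ two_ne_zero] at h1
      calc V s ≤ c' * V (2⁻¹ * s) := h1
        _ ≤ c' * c' ^ n := by gcongr
        _ = c' ^ (n + 1) := by ring
  rw [Metric.tendsto_nhds]
  intro ε hε
  obtain ⟨n, hn⟩ := exists_pow_lt_of_lt_one hε hc2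
  filter_upwards [hpow n, hpos] with s h1 h2
  rw [Real.dist_eq, sub_zero, abs_of_pos h2]
  exact h1.trans_lt hn

variable {Ω : Type*} [MeasurableSpace Ω] {P : Measure Ω} [IsProbabilityMeasure P]
  {X₁ X₂ : Ω → ℝ} {η : ℝ}

theorem antitone_jointTail : Antitone (jointTail X₁ X₂ P) := fun _ _ huv =>
  measureReal_mono fun _ hω => ⟨huv.trans_lt hω.1, huv.trans_lt hω.2⟩

theorem tendsto_inv_one_sub : Tendsto (fun u : ℝ => (1 - u)⁻¹) (𝓝[<] 1) atTop := by
  refine tendsto_inv_nhdsGT_zero.comp (tendsto_nhdsWithin_iff.2 ⟨?_, ?_⟩)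
  · have : Tendsto (fun u : ℝ => 1 - u) (𝓝 1) (𝓝 (1 - 1)) :=
      (continuous_const.sub continuous_id).tendsto 1
    rw [sub_self] at this
    exact this.mono_left nhdsWithin_le_nhds
  · filter_upwards [self_mem_nhdsWithin] with u hu
    have : u < 1 := hu
    simpa using this

/-- If `s ↦ jointTail (1 - s⁻¹)` is regularly varying with index `-1 / η`, then multiplying it by
`s ^ (1 / η)` gives the slowly varying function `L`, and the equivalence holds with equality. -/
theorem hasResidualTailDependenceCoeff_of_regularVariation (hη0 : 0 < η) (hη1 : η ≤ 1)
    (hpos : ∀ u ∈ Ioo (0 : ℝ) 1, 0 < jointTail X₁ X₂ P u)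
    (hG : ∀ t, 0 < t → Tendsto (fun s => jointTail X₁ X₂ P (1 - (t * s)⁻¹) /
      jointTail X₁ X₂ P (1 - s⁻¹)) atTop (𝓝 (t ^ (-(1 / η))))) :
    HasResidualTailDependenceCoeff X₁ X₂ P η := by
  refine ⟨hη0, hη1, fun s => if 1 < s then s ^ (1 / η) * jointTail X₁ X₂ P (1 - s⁻¹) else 1,
    ⟨?_, ?_, ?_⟩, ?_⟩
  · refine Measurable.ite measurableSet_Ioi ?_ measurable_const
    exact (by fun_prop : Measurable fun s : ℝ => s ^ (1 / η)).mul
      (antitone_jointTail.measurable.comp (by fun_prop))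
  · intro s hs
    split_ifs with h
    · exact mul_pos (Real.rpow_pos_of_pos hs _) (hpos _ (one_sub_inv_mem_Ioo h))
    · exact one_pos
  · intro t ht
    have h := (hG t ht).const_mul (t ^ (1 / η))
    rw [← Real.rpow_add ht, add_neg_cancel, Real.rpow_zero] at h
    refine h.congr' ?_
    filter_upwards [eventually_gt_atTop 1,
      (tendsto_id.const_mul_atTop ht).eventually_gt_atTop 1] with s h1 h2
    have h2 : 1 < t * s := h2
    have hs : 0 < s := by linarith
    rw [if_pos h1, if_pos h2, Real.mul_rpow ht.le hs.le]
    have := (Real.rpow_pos_of_pos hs (1 / η)).ne'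
    have := (hpos _ (one_sub_inv_mem_Ioo h1)).ne'
    field_simp
  · refine tendsto_const_nhds.congr' ?_
    filter_upwards [Ioo_mem_nhdsLT one_pos] with u hu
    have h0 : 0 < 1 - u := by linarith [hu.2]
    have h1 : 1 < (1 - u)⁻¹ := (one_lt_inv₀ h0).2 (by linarith [hu.1])
    rw [if_pos h1, inv_inv, sub_sub_cancel, mul_right_comm, ← Real.mul_rpow (by positivity) h0.le,
      inv_mul_cancel₀ h0.ne', Real.one_rpow, one_mul, div_self (hpos u hu).ne']

/-- If `s ↦ jointTail (1 - s⁻¹)` is regularly varying with an index below `-1`, it is negligible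
with respect to the marginal tail `s⁻¹`. -/
theorem asymptoticallyIndependent_of_regularVariation (hη0 : 0 < η) (hη1 : η < 1)
    (hpos : ∀ u ∈ Ioo (0 : ℝ) 1, 0 < jointTail X₁ X₂ P u)
    (hmarg : ∀ u ∈ Ioo (0 : ℝ) 1, marginalTail X₁ P u = 1 - u)
    (hG : ∀ t, 0 < t → Tendsto (fun s => jointTail X₁ X₂ P (1 - (t * s)⁻¹) /
      jointTail X₁ X₂ P (1 - s⁻¹)) atTop (𝓝 (t ^ (-(1 / η))))) :
    AsymptoticallyIndependent X₁ X₂ P := by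
  set V : ℝ → ℝ := fun s => s * jointTail X₁ X₂ P (1 - s⁻¹) with hV
  have hle : ∀ u, jointTail X₁ X₂ P u ≤ marginalTail X₁ P u := fun u =>
    measureReal_mono fun ω hω => hω.1
  have hV0 : Tendsto V atTop (𝓝 0) := by
    have hc : (2 : ℝ) * 2 ^ (-(1 / η)) < 1 := by
      have : (1 : ℝ) < 1 / η := (one_lt_div hη0).2 hη1
      calc (2 : ℝ) * 2 ^ (-(1 / η)) = 2 ^ (1 + -(1 / η)) := by
            rw [Real.rpow_add two_pos, Real.rpow_one]
        _ < 1 := Real.rpow_lt_one_of_one_lt_of_neg one_lt_two (by linarith)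
    refine tendsto_zero_of_doubling hc ?_ ?_ ?_
    · filter_upwards [eventually_gt_atTop 1] with s hs
      exact mul_pos (by linarith) (hpos _ (one_sub_inv_mem_Ioo hs))
    · filter_upwards [eventually_gt_atTop 1] with s hs
      have h := hle (1 - s⁻¹)
      have hs0 : 0 < s := by linarith
      rw [hmarg _ (one_sub_inv_mem_Ioo hs), sub_sub_cancel] at h
      calc V s ≤ s * s⁻¹ := by simp only [hV]; gcongr
        _ = 1 := mul_inv_cancel₀ hs0.ne'
    · refine ((hG 2 two_pos).const_mul 2).congr' ?_
      filter_upwards [eventually_gt_atTop 1] with s hs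
      have := (hpos _ (one_sub_inv_mem_Ioo hs)).ne'
      have hs0 : s ≠ 0 := by linarith
      simp only [hV]
      field_simp
  refine (hV0.comp tendsto_inv_one_sub).congr' ?_
  filter_upwards [Ioo_mem_nhdsLT one_pos] with u hu
  simp only [hV, Function.comp_apply]
  rw [hmarg u hu, inv_inv, sub_sub_cancel, inv_mul_eq_div]

end RegularVariation

/-! ### The laws of the coordinates and of the pair -/

section Coordinates

variable {Ω : Type*} [MeasurableSpace Ω] {P : Measure Ω} {lam κ ψ γ₁ γ₂ μ₁ μ₂ ρ : ℝ} {X₁ X₂ : Ω → ℝ}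

theorem Admissible.nonneg (h : Admissible lam κ ψ) : 0 ≤ κ := by
  rcases h with h | h | h
  exacts [h.2.1.le, h.2.1.le, h.2.1]

theorem eq_withDensity_of_lintegral {α : Type*} [MeasurableSpace α] {ν vol : Measure α}
    {F : α → ENNReal}
    (h : ∀ g : α → ENNReal, Measurable g → ∫⁻ x, g x ∂ν = ∫⁻ x, F x * g x ∂vol) :
    ν = vol.withDensity F := by
  ext s hs
  rw [← lintegral_indicator_one hs, h _ (measurable_one.indicator hs), withDensity_apply _ hs,
    ← lintegral_indicator hs]
  refine lintegral_congr fun y => ?_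
  by_cases hy : y ∈ s <;> simp [hy]

/-- The law of each coordinate has a density proportional to `ghDensity₁`. The constant is positive
because the law has mass one; in particular the normalizing integral does not vanish. -/
theorem exists_map_coord_eq_withDensity [IsProbabilityMeasure P] {d : ℕ}
    {γ μ : EuclideanSpace ℝ (Fin d)}
    {S : Matrix (Fin d) (Fin d) ℝ} {Y : Ω → EuclideanSpace ℝ (Fin d)} (hκ : 0 ≤ κ) (hψ : 0 < ψ)
    (hS : S.PosSemidef) {i : Fin d} (hSi : S i i = 1) (hY : HasLaw Y (ghMeasure lam κ ψ γ μ S) P) :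
    (∫ t in Ioi (0 : ℝ), gigKernel lam κ ψ t) ≠ 0 ∧ ∃ c > 0, P.map (fun ω => Y ω i)
      = volume.withDensity fun x => ENNReal.ofReal (c * ghDensity₁ lam κ ψ (γ i) (μ i) x) := by
  have hI0 : 0 ≤ ∫ t in Ioi (0 : ℝ), gigKernel lam κ ψ t :=
    setIntegral_nonneg measurableSet_Ioi fun t ht => (gigKernel_pos ht).le
  have hYi : AEMeasurable (fun ω => Y ω i) P :=
    (by fun_prop : Measurable fun v : EuclideanSpace ℝ (Fin d) => v i).comp_aemeasurable
      hY.aemeasurable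
  have := Measure.isProbabilityMeasure_map hYi
  have hlaw : P.map (fun ω => Y ω i) = volume.withDensity fun x => ENNReal.ofReal
      ((∫ t in Ioi (0 : ℝ), gigKernel lam κ ψ t)⁻¹ * (Real.sqrt (2 * Real.pi))⁻¹ *
        Real.exp (-(γ i * μ i)) * ghDensity₁ lam κ ψ (γ i) (μ i) x) := by
    have hm : Measurable fun v : EuclideanSpace ℝ (Fin d) => v i := by fun_prop
    refine eq_withDensity_of_lintegral fun g hg => ?_
    rw [← lintegral_ghMeasure_coord hκ hψ hS hSi hg, ← hY.map_eq, ← lintegral_map hg hm,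
      AEMeasurable.map_map_of_aemeasurable hm.aemeasurable hY.aemeasurable]
    rfl
  have hI : (∫ t in Ioi (0 : ℝ), gigKernel lam κ ψ t) ≠ 0 := by
    intro h
    have hu := measure_univ (μ := P.map (fun ω => Y ω i))
    rw [hlaw, h] at hu
    simp at hu
  refine ⟨hI, _, ?_, hlaw⟩
  have := hI0.lt_of_ne' hI
  positivity

theorem exists_map_pair_eq_withDensity (hκ : 0 ≤ κ) (hψ : 0 < ψ) (hρ : |ρ| < 1)
    (hI : (∫ t in Ioi (0 : ℝ), gigKernel lam κ ψ t) ≠ 0)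
    (hX : HasLaw (fun ω => !₂[X₁ ω, X₂ ω])
      (ghMeasure lam κ ψ !₂[γ₁, γ₂] !₂[μ₁, μ₂] !![1, ρ; ρ, 1]) P) :
    ∃ c > 0, P.map (fun ω => (X₁ ω, X₂ ω)) = volume.withDensity fun x =>
      ENNReal.ofReal (c * ghDensity₂ lam κ ψ γ₁ γ₂ μ₁ μ₂ ρ x) := by
  have hI0 : 0 ≤ ∫ t in Ioi (0 : ℝ), gigKernel lam κ ψ t :=
    setIntegral_nonneg measurableSet_Ioi fun t ht => (gigKernel_pos ht).le
  have hm : Measurable fun v : EuclideanSpace ℝ (Fin 2) => (v 0, v 1) := by fun_prop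
  have hXm : AEMeasurable (fun ω => (X₁ ω, X₂ ω)) P := hm.comp_aemeasurable hX.aemeasurable
  refine ⟨(∫ t in Ioi (0 : ℝ), gigKernel lam κ ψ t)⁻¹ *
        (2 * Real.pi * Real.sqrt (1 - ρ ^ 2))⁻¹ * Real.exp (-tilt γ₁ γ₂ ρ (μ₁, μ₂)), ?_, ?_⟩
  · have := hI0.lt_of_ne' hI
    have := Real.sqrt_pos.2 (one_sub_sq_pos hρ)
    positivity
  · refine eq_withDensity_of_lintegral fun g hg => ?_
    rw [← lintegral_ghMeasure_pair hκ hψ hρ hg, ← hX.map_eq, ← lintegral_map hg hm,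
      AEMeasurable.map_map_of_aemeasurable hm.aemeasurable hX.aemeasurable]
    rfl

variable {m₁ m₂ : ℝ}

theorem decayRate_whitening_fst (hρ : |ρ| < 1) (θ : ℝ) :
    decayRate θ (whitening ρ) (tilt γ₁ γ₂ ρ) (m₁, m₂) (1, 0)
      = θ * ((m₁ - ρ * m₂) / (1 - ρ ^ 2) /
        Real.sqrt ((m₁ ^ 2 - 2 * ρ * m₁ * m₂ + m₂ ^ 2) / (1 - ρ ^ 2)))
      - (γ₁ - ρ * γ₂) / (1 - ρ ^ 2) := by
  simp only [decayRate, inner_whitening hρ, norm_whitening hρ, tilt_apply]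
  ring_nf

theorem decayRate_whitening_snd (hρ : |ρ| < 1) (θ : ℝ) :
    decayRate θ (whitening ρ) (tilt γ₁ γ₂ ρ) (m₁, m₂) (0, 1)
      = θ * ((m₂ - ρ * m₁) / (1 - ρ ^ 2) /
        Real.sqrt ((m₂ ^ 2 - 2 * ρ * m₂ * m₁ + m₁ ^ 2) / (1 - ρ ^ 2)))
      - (γ₂ - ρ * γ₁) / (1 - ρ ^ 2) := by
  simp only [decayRate, inner_whitening hρ, norm_whitening hρ, tilt_apply]
  ring_nf

/-- Euler's identity for the homogeneous rate function. -/
theorem decayRate_whitening_smul_self (hρ : |ρ| < 1) (hm : 0 < m₁) (θ t : ℝ) :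
    decayRate θ (whitening ρ) (tilt γ₁ γ₂ ρ) (m₁, m₂) (t * m₁, t * m₂)
      = t * (θ * Real.sqrt ((m₁ ^ 2 - 2 * ρ * m₁ * m₂ + m₂ ^ 2) / (1 - ρ ^ 2))
      - (m₁ * (γ₁ - ρ * γ₂) + m₂ * (γ₂ - ρ * γ₁)) / (1 - ρ ^ 2)) := by
  have hQ : 0 < (m₁ ^ 2 - 2 * ρ * m₁ * m₂ + m₂ ^ 2) / (1 - ρ ^ 2) :=
    div_pos (quad_form_pos hρ hm) (one_sub_sq_pos hρ)
  simp only [decayRate, inner_whitening hρ, norm_whitening hρ, tilt_apply]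
  set Q := (m₁ ^ 2 - 2 * ρ * m₁ * m₂ + m₂ ^ 2) / (1 - ρ ^ 2) with hQdef
  have e : (m₁ * (t * m₁) - ρ * (m₁ * (t * m₂) + m₂ * (t * m₁)) + m₂ * (t * m₂)) / (1 - ρ ^ 2)
      = t * (Real.sqrt Q * Real.sqrt Q) := by
    rw [Real.mul_self_sqrt hQ.le, hQdef]
    ring
  rw [e, ← mul_assoc, mul_div_cancel_right₀ _ (Real.sqrt_pos.2 hQ).ne']
  ring

end Coordinates

end GHTail

open GHTail

theorem proposition1 {Ω : Type*} [MeasurableSpace Ω] (P : Measure Ω) [IsProbabilityMeasure P]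
    (lam κ ψ γ₁ γ₂ μ₁ μ₂ ρ : ℝ) (hadm : GHTail.Admissible lam κ ψ) (hψ : 0 < ψ) (hρ : |ρ| < 1)
    (X₁ X₂ : Ω → ℝ)
    (hX : HasLaw (fun ω => !₂[X₁ ω, X₂ ω])
      (GHTail.ghMeasure lam κ ψ !₂[γ₁, γ₂] !₂[μ₁, μ₂] !![1, ρ; ρ, 1]) P)
    (m₁ m₂ : ℝ) (hm₁ : m₁ = (γ₁ + Real.sqrt (ψ + γ₁ ^ 2)) / ψ)
    (hm₂ : m₂ = (γ₂ + Real.sqrt (ψ + γ₂ ^ 2)) / ψ) :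
    GHTail.AsymptoticallyIndependent X₁ X₂ P ∧
    GHTail.HasResidualTailDependenceCoeff X₁ X₂ P
      ((1 - ρ ^ 2) /
        (Real.sqrt ((ψ * (1 - ρ ^ 2) + γ₁ ^ 2 - 2 * ρ * γ₁ * γ₂ + γ₂ ^ 2) *
            (m₁ ^ 2 - 2 * ρ * m₁ * m₂ + m₂ ^ 2))
          - m₁ * (γ₁ - ρ * γ₂) - m₂ * (γ₂ - ρ * γ₁))) := by
  have hκ := hadm.nonneg
  have hD := one_sub_sq_pos hρ
  have p1 := marginal_scale_pos hψ hm₁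
  have p2 := marginal_scale_pos hψ hm₂
  rw [residual_coeff_eq_inv hψ hρ]
  have hg := one_lt_joint_rate hψ hρ hm₁ hm₂
  have hr1 := corner_rate_pos hψ hρ hm₁ hm₂
  have hr2 := corner_rate_pos hψ hρ hm₂ hm₁
  rw [show γ₂ ^ 2 - 2 * ρ * γ₂ * γ₁ + γ₁ ^ 2 = γ₁ ^ 2 - 2 * ρ * γ₁ * γ₂ + γ₂ ^ 2 by ring] at hr2
  have hA : 0 < ψ + (γ₁ ^ 2 - 2 * ρ * γ₁ * γ₂ + γ₂ ^ 2) / (1 - ρ ^ 2) := by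
    have := div_nonneg (quad_form_nonneg γ₁ γ₂ hρ) hD.le
    linarith
  rw [← decayRate_whitening_fst hρ] at hr1
  rw [← decayRate_whitening_snd hρ] at hr2
  have hsmul := fun t => decayRate_whitening_smul_self (γ₁ := γ₁) (γ₂ := γ₂) (m₂ := m₂) hρ p1
    (Real.sqrt (ψ + (γ₁ ^ 2 - 2 * ρ * γ₁ * γ₂ + γ₂ ^ 2) / (1 - ρ ^ 2))) t
  set A := ψ + (γ₁ ^ 2 - 2 * ρ * γ₁ * γ₂ + γ₂ ^ 2) / (1 - ρ ^ 2) with hAdef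
  set g := Real.sqrt A * Real.sqrt ((m₁ ^ 2 - 2 * ρ * m₁ * m₂ + m₂ ^ 2) / (1 - ρ ^ 2))
      - (m₁ * (γ₁ - ρ * γ₂) + m₂ * (γ₂ - ρ * γ₁)) / (1 - ρ ^ 2) with hgdef
  have hS := posSemidef_corrMatrix hρ
  obtain ⟨hI, c₁, hc₁, hlaw₁⟩ := exists_map_coord_eq_withDensity (i := 0) hκ hψ hS rfl hX
  obtain ⟨-, c₂, hc₂, hlaw₂⟩ := exists_map_coord_eq_withDensity (i := 1) hκ hψ hS rfl hX
  simp only [Matrix.cons_val_zero, Matrix.cons_val_one] at hlaw₁ hlaw₂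
  obtain ⟨c, hc, hlaw⟩ := exists_map_pair_eq_withDensity hκ hψ hρ hI hX
  have hXm : AEMeasurable (fun ω => (X₁ ω, X₂ ω)) P :=
    (by fun_prop : Measurable fun v : EuclideanSpace ℝ (Fin 2) => (v 0, v 1)).comp_aemeasurable
      hX.aemeasurable
  have hX₁ : AEMeasurable X₁ P := measurable_fst.comp_aemeasurable hXm
  have hX₂ : AEMeasurable X₂ P := measurable_snd.comp_aemeasurable hXm
  have := Measure.isProbabilityMeasure_map hX₁
  have := Measure.isProbabilityMeasure_map hX₂
  have := Measure.isProbabilityMeasure_map hXm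
  obtain ⟨q₁, hq₁, hT₁, hlog₁, hsub₁⟩ := exists_quantile_of_hasExpRate
    ((measurable_ghDensity₁ lam κ ψ γ₁ μ₁).const_mul c₁)
    (fun x => mul_pos hc₁ (ghDensity₁_pos lam κ γ₁ μ₁ x hψ)) hlaw₁
    (by rw [← inv_marginal_scale hψ hm₁]; positivity)
    ((hasExpRate_ghDensity₁ lam γ₁ μ₁ hκ hψ).const_mul hc₁.le)
  obtain ⟨q₂, hq₂, -, hlog₂, hsub₂⟩ := exists_quantile_of_hasExpRate
    ((measurable_ghDensity₁ lam κ ψ γ₂ μ₂).const_mul c₂)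
    (fun x => mul_pos hc₂ (ghDensity₁_pos lam κ γ₂ μ₂ x hψ)) hlaw₂
    (by rw [← inv_marginal_scale hψ hm₂]; positivity)
    ((hasExpRate_ghDensity₁ lam γ₂ μ₂ hκ hψ).const_mul hc₂.le)
  rw [← inv_marginal_scale hψ hm₁, inv_inv] at hlog₁ hsub₁
  rw [← inv_marginal_scale hψ hm₂, inv_inv] at hlog₂ hsub₂
  have hmarg : ∀ u ∈ Ioo (0 : ℝ) 1, marginalTail X₁ P u = 1 - u := by
    intro u hu
    rw [← hT₁ u hu, map_measureReal_apply_of_aemeasurable hX₁ measurableSet_Ioi, marginalTail]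
    simp only [hq₁ u hu]
    rfl
  have hjoint : ∀ u ∈ Ioo (0 : ℝ) 1, jointTail X₁ X₂ P u
      = (P.map fun ω => (X₁ ω, X₂ ω)).real (Ioi (q₁ u) ×ˢ Ioi (q₂ u)) := by
    intro u hu
    rw [map_measureReal_apply_of_aemeasurable hXm (measurableSet_Ioi.prod measurableSet_Ioi),
      jointTail]
    simp only [hq₁ u hu, hq₂ u hu]
    rfl
  have hH0 := radialFactor_pos (lam - 1) hA
  have hfpos : ∀ x, 0 < c * ghDensity₂ lam κ ψ γ₁ γ₂ μ₁ μ₂ ρ x :=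
    fun x => mul_pos hc (tiltedDensity_pos hH0 x)
  have hfm : Measurable fun x => c * ghDensity₂ lam κ ψ γ₁ γ₂ μ₁ μ₂ ρ x :=
    (measurable_tiltedDensity (measurable_radialFactor _ _)).const_mul c
  have hpos : ∀ u ∈ Ioo (0 : ℝ) 1, 0 < jointTail X₁ X₂ P u := by
    intro u hu
    rw [hjoint u hu]
    exact measureReal_pos_of_eq_withDensity hfm hfpos hlaw
      ((isOpen_Ioi.prod isOpen_Ioi).measure_pos _
        (nonempty_Ioi.prod nonempty_Ioi)).ne'
  have hquad : ∀ x : ℝ × ℝ, (P.map fun ω => (X₁ ω, X₂ ω)).real (Ioi x.1 ×ˢ Ioi x.2)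
      = c * ∫ a in Ioi (0 : ℝ) ×ˢ Ioi (0 : ℝ), ghDensity₂ lam κ ψ γ₁ γ₂ μ₁ μ₂ ρ (a + x) := by
    intro x
    rw [measureReal_eq_integral_of_eq_withDensity hfm hfpos hlaw
      (measurableSet_Ioi.prod measurableSet_Ioi), integral_const_mul]
    have h := (measurePreserving_add_right volume x).setIntegral_preimage_emb
      (measurableEmbedding_addRight x) (ghDensity₂ lam κ ψ γ₁ γ₂ μ₁ μ₂ ρ) (Ioi x.1 ×ˢ Ioi x.2)
    have hpre : (fun a => a + x) ⁻¹' (Ioi x.1 ×ˢ Ioi x.2) = Ioi (0 : ℝ) ×ˢ Ioi (0 : ℝ) := by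
      ext a
      simp
    rw [← h, hpre]
  have hMm : whitening ρ (m₁, m₂) ≠ 0 := by
    rw [← norm_ne_zero_iff, norm_whitening hρ]
    exact (Real.sqrt_pos.2 (div_pos (quad_form_pos hρ p1) hD)).ne'
  have hG : ∀ t, 0 < t → Tendsto (fun s => jointTail X₁ X₂ P (1 - (t * s)⁻¹) /
      jointTail X₁ X₂ P (1 - s⁻¹)) atTop (𝓝 (t ^ (-(1 / g⁻¹)))) := by
    intro t ht
    have hb := (hsub₁ t ht).prodMk_nhds (hsub₂ t ht)
    have hy : Tendsto (fun s => (Real.log s)⁻¹ • (q₁ (1 - s⁻¹), q₂ (1 - s⁻¹))) atTop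
        (𝓝 (m₁, m₂)) := by
      simpa using hlog₁.prodMk_nhds hlog₂
    have h := tendsto_integral_quadrant_shift_div (w₀ := whiteningOffset κ μ₁ μ₂ ρ)
      (measurable_radialFactor (lam - 1) A) (hasExpRate_radialFactor (lam - 1) hA) hH0
      (Real.sqrt_nonneg A) hMm (sub_le_norm_whitening_add κ μ₁ μ₂ ρ) hr1 hr2 p1
      Real.tendsto_log_atTop hy hb
    rw [hsmul] at h
    have e : Real.exp (-(Real.log t * g)) = t ^ (-(1 / g⁻¹)) := by
      rw [one_div, inv_inv, Real.rpow_def_of_pos ht]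
      congr 1
      ring
    rw [e] at h
    refine h.congr' ?_
    filter_upwards [eventually_gt_atTop 1,
      (tendsto_id.const_mul_atTop ht).eventually_gt_atTop 1] with s h1 h2
    rw [hjoint _ (one_sub_inv_mem_Ioo h1), hjoint _ (one_sub_inv_mem_Ioo (s := t * s) h2),
      hquad (_, _), hquad (_, _), mul_div_mul_left _ _ hc.ne']
    simp only [Prod.mk_add_mk, sub_add_cancel]
    rfl
  have hg1 : g⁻¹ < 1 := inv_lt_one_of_one_lt₀ hg
  have hg0 : 0 < g⁻¹ := inv_pos.2 (by linarith)
  exact ⟨asymptoticallyIndependent_of_regularVariation hg0 hg1 hpos hmarg hG,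
    hasResidualTailDependenceCoeff_of_regularVariation hg0 hg1.le hpos hG⟩
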